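/- Let $G=\mathbb{R}^3$ be the Heisenberg group with the product $(x,y,z)(x',y',z')=(x+x',\,y+y',\,z+z'+(xy'-x'y))$, let $\Gamma=\mathbb{Z}^3\subset G$ be the subgroup of integer points, and let $X=G/\Gamma$ with the quotient topology, on which $G$ acts by left translation. Write $\mathbb{T}^1=\mathbb{R}/\mathbb{Z}$ and $\mathbb{T}^2=\mathbb{R}^2/\mathbb{Z}^2$. Let $\alpha,\beta\in\mathbb{R}$ be such that $\alpha,\beta,1$ are linearly independent over $\mathbb{Q}$, and let $h:\mathbb{T}^2\to\mathbb{T}^1$ be Lipschitz continuous. Define $T:X\to X$ by $$T(\mathbf{x})=(\alpha,\beta,\tilde h(x,y))\,\mathbf{x}\qquad\text{for }\mathbf{x}=(x,y,z)\Gamma,$$ where $\tilde h(x,y)\in\mathbb{R}$ is any lift of $h(x \bmod 1,\,y \bmod 1)\in\mathbb{T}^1$ ($T$ does not depend on the choice of the lift or of the representative $(x,y,z)$). Then for every $\mathbf{x}\in X$ and every continuous $f:X\to\mathbb{C}$, $$\lim_{N\to\infty}\frac1N\sum_{n=1}^{N}f(T^n\mathbf{x})\,\mu(n)=0,$$ where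 $\mu$ is the Möbius function. -/

import Mathlib

/-- The real Heisenberg group, as triples of real numbers. -/
@[ext]
structure Heis where
  x : ℝ
  y : ℝ
  z : ℝ

namespace Heis

/-- `(x,y,z)(x',y',z') = (x+x', y+y', z+z'+(xy'-x'y))`. -/
instance : Mul Heis :=
  ⟨fun a b => ⟨a.x + b.x, a.y + b.y, a.z + b.z + (a.x * b.y - b.x * a.y)⟩⟩

instance : One Heis := ⟨⟨0, 0, 0⟩⟩

instance : Inv Heis := ⟨fun a => ⟨-a.x, -a.y, -a.z⟩⟩

theorem mul_def (a b : Heis) :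
    a * b = ⟨a.x + b.x, a.y + b.y, a.z + b.z + (a.x * b.y - b.x * a.y)⟩ := rfl

theorem one_def : (1 : Heis) = ⟨0, 0, 0⟩ := rfl

theorem inv_def (a : Heis) : a⁻¹ = ⟨-a.x, -a.y, -a.z⟩ := rfl

instance : Group Heis :=
  Group.ofLeftAxioms
    (by intro a b c; simp only [mul_def]; ext <;> simp only [] <;> ring)
    (by intro a; simp only [mul_def, one_def]; ext <;> simp)
    (by intro a; simp only [mul_def, one_def, inv_def]; ext <;> simp only [] <;> ring)

/-- The identification of the Heisenberg group with `ℝ³` as a set. -/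
def equivProd : Heis ≃ ℝ × ℝ × ℝ where
  toFun a := (a.x, a.y, a.z)
  invFun p := ⟨p.1, p.2.1, p.2.2⟩
  left_inv _ := rfl
  right_inv _ := rfl

/-- The usual topology of `ℝ³`. -/
instance : TopologicalSpace Heis := TopologicalSpace.induced equivProd inferInstance

/-- The lattice of integer points. -/
def lattice : Subgroup Heis where
  carrier := {g | ∃ a b c : ℤ, g = ⟨a, b, c⟩}
  mul_mem' := by
    rintro _ _ ⟨a, b, c, rfl⟩ ⟨a', b', c', rfl⟩
    exact ⟨a + a', b + b', c + c' + (a * b' - a' * b), by simp [mul_def]⟩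
  one_mem' := ⟨0, 0, 0, by simp [one_def]⟩
  inv_mem' := by
    rintro _ ⟨a, b, c, rfl⟩
    exact ⟨-a, -b, -c, by simp [inv_def]⟩

end Heis

/-- The Heisenberg nilmanifold `G/Γ` (left cosets `gΓ`), with the quotient topology and the
action of `G` by left translation. -/
abbrev HeisNil : Type := Heis ⧸ Heis.lattice

namespace HeisNil

/-- The projection `(x,y,z)Γ ↦ (x mod 1, y mod 1)` to the two-dimensional torus. -/
noncomputable def toTorus : HeisNil → UnitAddCircle × UnitAddCircle :=
  Quotient.lift (fun g : Heis => ((g.x : UnitAddCircle), (g.y : UnitAddCircle))) (by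
    intro g g' h
    obtain ⟨a, b, c, hγ⟩ := QuotientGroup.leftRel_apply.mp h
    have hg : g' = g * ⟨a, b, c⟩ := by rw [← hγ]; group
    subst hg
    simp [Heis.mul_def])

/-- The skew product `𝐱 ↦ (α, β, h(x,y)) 𝐱` for `𝐱 = (x,y,z)Γ`, where the value `h(x,y) ∈ ℝ/ℤ` is
lifted to its representative in `[0,1)`; see `skew_mk` for the independence of the lift. -/
noncomputable def skew (α β : ℝ) (h : UnitAddCircle × UnitAddCircle → UnitAddCircle)
    (p : HeisNil) : HeisNil :=
  (⟨α, β, (AddCircle.equivIco (1 : ℝ) 0 (h (toTorus p)) : ℝ)⟩ : Heis) • p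

/-- Any lift `t` of `h(x,y)` to `ℝ` gives the same map. -/
theorem skew_mk (α β : ℝ) (h : UnitAddCircle × UnitAddCircle → UnitAddCircle) (g : Heis) (t : ℝ)
    (ht : (t : UnitAddCircle) = h ((g.x : UnitAddCircle), (g.y : UnitAddCircle))) :
    skew α β h (QuotientGroup.mk g) = QuotientGroup.mk ((⟨α, β, t⟩ : Heis) * g) := by
  have key : toTorus (QuotientGroup.mk g) = ((g.x : UnitAddCircle), (g.y : UnitAddCircle)) := rfl
  have hs : ((AddCircle.equivIco (1 : ℝ) 0 (t : UnitAddCircle) : ℝ) : UnitAddCircle) = t :=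
    (AddCircle.equivIco (1 : ℝ) 0).symm_apply_apply _
  unfold skew
  rw [key, ← ht]
  generalize (AddCircle.equivIco (1 : ℝ) 0 (t : UnitAddCircle) : ℝ) = s at hs
  obtain ⟨m, hm⟩ := (AddCircle.coe_eq_zero_iff (1 : ℝ) (x := t - s)).mp (by simp [hs])
  have hm' : t = s + m := by simp at hm; linarith
  refine QuotientGroup.eq.mpr ⟨0, 0, m, ?_⟩
  simp only [Heis.mul_def, Heis.inv_def, hm', smul_eq_mul]
  ext <;> simp only [Int.cast_zero] <;> ring

end HeisNil

/-!
By the criterion of Kátai and of Bourgain, Sarnak and Ziegler, it suffices that for distinct primes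
`p` and `q` the sequence `f (T^(p n) x) * conj (f (T^(q n) x))` has mean value zero. Expanding `f`
in a Fourier series for the action of the centre of the Heisenberg group, one may assume that the
centre acts on `f` through the character of some frequency `m`.

If `m = 0`, then `f` lives on the torus, where it can be approximated by characters. The nontrivial
ones satisfy the criterion because `α, β, 1` are independent over `ℚ`, and the trivial one is
the prime number theorem in the form `∑ n ≤ N, μ(n) = o(N)`.

If `m ≠ 0`, van der Corput's inequality reduces the claim to the decay, as `k → ∞`, of the integral
over the torus of `G (p k) (w₀ + p w) * conj (G (q k) (w₀ + q w))`, where `G j` is the correlation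
`f ∘ T^j * conj f`, on which the centre acts trivially. Translate `w` by `s / k` in the second
coordinate. Since the Birkhoff sums of length `p k` of a Lipschitz function change by `o(1)` in `L²`
under a translation of size `O(1 / k)`, this multiplies `G (p k) (w₀ + p w)` asymptotically by the
phase `e(m p² (B + 2 α) s)`, where `B` is the degree of `h` in the second coordinate. As `B + 2 α`
is irrational, `s` can be chosen so that the phases for `p` and `q` are opposite, and the integral
is asymptotic to its own negative.
-/

open Finset Filter Topology MeasureTheory
open scoped ComplexConjugate FourierTransform
open UnitAddTorus (mFourier mFourierCoeff)

/-- The sequence `u 1, u 2, …` has mean value `l`: its Cesàro averages tend to `l`. -/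
def HasMean (u : ℕ → ℂ) (l : ℂ) : Prop :=
  Tendsto (fun N : ℕ => (1 / (N : ℂ)) * ∑ n ∈ Icc 1 N, u n) atTop (𝓝 l)

theorem hasMean_zero_iff {u : ℕ → ℂ} :
    HasMean u 0 ↔ ∀ ε : ℝ, 0 < ε → ∀ᶠ N : ℕ in atTop, ‖∑ n ∈ Icc 1 N, u n‖ ≤ ε * N := by
  rw [HasMean, Metric.nhds_basis_closedBall.tendsto_right_iff]
  refine forall₂_congr fun ε hε => eventually_congr (Eventually.of_forall fun N => ?_)
  rcases N.eq_zero_or_pos with rfl | hN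
  · simp [hε.le]
  · rw [mem_closedBall_zero_iff, norm_mul, norm_div, norm_one, Complex.norm_natCast,
      one_div_mul_eq_div, div_le_iff₀ (by exact_mod_cast hN)]

namespace HasMean

variable {u v : ℕ → ℂ} {a b : ℂ}

theorem add (hu : HasMean u a) (hv : HasMean v b) : HasMean (fun n => u n + v n) (a + b) := by
  simpa only [HasMean, sum_add_distrib, mul_add] using Tendsto.add hu hv

theorem const_mul (c : ℂ) (hu : HasMean u a) : HasMean (fun n => c * u n) (c * a) := by
  simpa only [HasMean, ← mul_sum, mul_left_comm _ c] using Tendsto.const_mul c hu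

theorem const (c : ℂ) : HasMean (fun _ => c) c := by
  refine tendsto_const_nhds.congr' ?_
  filter_upwards [eventually_ne_atTop 0] with N hN
  simp [hN]

theorem of_uniform_approx (h : ∀ ε : ℝ, 0 < ε → ∃ v, HasMean v 0 ∧ ∀ n, ‖u n - v n‖ ≤ ε) :
    HasMean u 0 := by
  refine hasMean_zero_iff.2 fun ε hε => ?_
  obtain ⟨v, hv, huv⟩ := h (ε / 2) (half_pos hε)
  filter_upwards [hasMean_zero_iff.1 hv (ε / 2) (half_pos hε)] with N hN
  have hdiff : ‖∑ n ∈ Icc 1 N, (u n - v n)‖ ≤ N * (ε / 2) := by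
    simpa using norm_sum_le_of_le (Icc 1 N) fun n _ => huv n
  calc ‖∑ n ∈ Icc 1 N, u n‖
      = ‖∑ n ∈ Icc 1 N, (u n - v n) + ∑ n ∈ Icc 1 N, v n‖ := by simp [sum_sub_distrib]
    _ ≤ N * (ε / 2) + ε / 2 * N := norm_add_le_of_le hdiff hN
    _ = ε * N := by ring

end HasMean

theorem sum_Icc_filter_dvd {E : Type*} [AddCommMonoid E] (g : ℕ → E) {p : ℕ} (hp : 0 < p)
    (N : ℕ) : ∑ n ∈ Icc 1 N with p ∣ n, g n = ∑ m ∈ Icc 1 (N / p), g (p * m) := by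
  have himage : {n ∈ Icc 1 N | p ∣ n} = (Icc 1 (N / p)).image (p * ·) := by
    ext n
    simp only [mem_filter, mem_Icc, mem_image, Nat.le_div_iff_mul_le hp]
    constructor
    · rintro ⟨⟨h1, hN⟩, m, rfl⟩
      exact ⟨m, ⟨Nat.pos_of_mul_pos_left h1, by rwa [mul_comm]⟩, rfl⟩
    · rintro ⟨m, ⟨h1, hN⟩, rfl⟩
      exact ⟨⟨Nat.mul_pos hp h1, by rwa [mul_comm]⟩, dvd_mul_right p m⟩
  rw [himage, sum_image fun _ _ _ _ h => Nat.eq_of_mul_eq_mul_left hp h]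

theorem sum_Icc_ite_mul_le {E : Type*} [AddCommMonoid E] (g : ℕ → E) {p : ℕ} (hp : 0 < p)
    (N : ℕ) : ∑ m ∈ Icc 1 N, (if p * m ≤ N then g m else 0) = ∑ m ∈ Icc 1 (N / p), g m := by
  rw [← sum_filter]
  congr 1
  ext m
  rw [mem_filter, mem_Icc, mem_Icc, Nat.le_div_iff_mul_le hp, mul_comm m p, and_assoc,
    and_congr_right_iff, and_iff_right_iff_imp]
  exact fun _ h => (Nat.le_mul_of_pos_left m hp).trans h

theorem card_Icc_filter_dvd (p N : ℕ) : #{n ∈ Icc 1 N | p ∣ n} = N / p :=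
  Nat.Ioc_filter_dvd_card_eq_div N p

section TuranKubilius

theorem sub_one_le_card_filter_dvd (p N : ℕ) :
    (N : ℝ) * (1 / p) - 1 ≤ #{n ∈ Icc 1 N | p ∣ n} := by
  rw [card_Icc_filter_dvd, ← Nat.floor_div_eq_div (K := ℝ), mul_one_div]
  exact (Nat.sub_one_lt_floor _).le

theorem card_filter_dvd_le (p N : ℕ) : (#{n ∈ Icc 1 N | p ∣ n} : ℝ) ≤ N * (1 / p) := by
  rw [card_Icc_filter_dvd, mul_one_div]
  exact Nat.cast_div_le

theorem card_filter_dvd_and_dvd_le {p q : ℕ} (hp : p.Prime) (hq : q.Prime) (N : ℕ) :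
    (#{n ∈ Icc 1 N | p ∣ n ∧ q ∣ n} : ℝ) ≤
      N * (1 / p * (1 / q)) + if p = q then N * (1 / p : ℝ) else 0 := by
  split_ifs with hpq
  · subst hpq
    simp only [and_self]
    exact (card_filter_dvd_le p N).trans (le_add_of_nonneg_left (by positivity))
  · have hmul : ∀ n, p ∣ n ∧ q ∣ n ↔ p * q ∣ n := fun n =>
      ⟨fun h => ((Nat.coprime_primes hp hq).2 hpq).mul_dvd_of_dvd_of_dvd h.1 h.2,
        fun h => ⟨dvd_of_mul_right_dvd h, dvd_of_mul_left_dvd h⟩⟩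
    simp only [hmul, add_zero]
    refine (card_filter_dvd_le (p * q) N).trans_eq ?_
    push_cast
    ring

variable (P : Finset ℕ) (N : ℕ)

theorem sum_card_filter_dvd :
    ∑ n ∈ Icc 1 N, #{p ∈ P | p ∣ n} = ∑ p ∈ P, #{n ∈ Icc 1 N | p ∣ n} :=
  sum_card_bipartiteAbove_eq_sum_card_bipartiteBelow fun n p => p ∣ n

theorem sum_card_filter_dvd_sq :
    ∑ n ∈ Icc 1 N, #{p ∈ P | p ∣ n} ^ 2 =
      ∑ p ∈ P, ∑ q ∈ P, #{n ∈ Icc 1 N | p ∣ n ∧ q ∣ n} := by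
  have hpairs : ∀ n, #{p ∈ P | p ∣ n} ^ 2 = #{x ∈ P ×ˢ P | x.1 ∣ n ∧ x.2 ∣ n} := fun n => by
    rw [filter_product (· ∣ n) (· ∣ n), card_product, sq]
  simp_rw [hpairs, ← sum_product']
  exact sum_card_bipartiteAbove_eq_sum_card_bipartiteBelow fun n (x : ℕ × ℕ) => x.1 ∣ n ∧ x.2 ∣ n

theorem le_sum_card_filter_dvd :
    N * ∑ p ∈ P, (1 / p : ℝ) - #P ≤ ∑ n ∈ Icc 1 N, (#{p ∈ P | p ∣ n} : ℝ) := by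
  have h := sum_le_sum fun p (_ : p ∈ P) => sub_one_le_card_filter_dvd p N
  rw [sum_sub_distrib, ← mul_sum, sum_const, nsmul_one] at h
  exact_mod_cast h.trans_eq (by exact_mod_cast (sum_card_filter_dvd P N).symm)

variable {P}

theorem sum_card_filter_dvd_sq_le (hP : ∀ p ∈ P, p.Prime) :
    ∑ n ∈ Icc 1 N, (#{p ∈ P | p ∣ n} : ℝ) ^ 2 ≤
      N * ((∑ p ∈ P, (1 / p : ℝ)) ^ 2 + ∑ p ∈ P, (1 / p : ℝ)) := by
  calc ∑ n ∈ Icc 1 N, (#{p ∈ P | p ∣ n} : ℝ) ^ 2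
      = ∑ p ∈ P, ∑ q ∈ P, (#{n ∈ Icc 1 N | p ∣ n ∧ q ∣ n} : ℝ) := by
        exact_mod_cast sum_card_filter_dvd_sq P N
    _ ≤ ∑ p ∈ P, ∑ q ∈ P, (N * (1 / p * (1 / q)) + if p = q then N * (1 / p : ℝ) else 0) :=
        sum_le_sum fun p hp => sum_le_sum fun q hq =>
          card_filter_dvd_and_dvd_le (hP p hp) (hP q hq) N
    _ = N * ((∑ p ∈ P, (1 / p : ℝ)) ^ 2 + ∑ p ∈ P, (1 / p : ℝ)) := by
        simp only [sum_add_distrib, sum_ite_eq, ← mul_sum, ← sum_mul, sq, mul_add]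
        congr 1
        rw [mul_sum]
        exact sum_congr rfl fun p hp => if_pos hp

theorem sum_card_primeDivisors_sub_sq_le (hP : ∀ p ∈ P, p.Prime) :
    ∑ n ∈ Icc 1 N, ((#{p ∈ P | p ∣ n} : ℝ) - ∑ p ∈ P, (1 / p : ℝ)) ^ 2 ≤
      N * (∑ p ∈ P, (1 / p : ℝ)) + 2 * (∑ p ∈ P, (1 / p : ℝ)) * #P := by
  have hfirst := le_sum_card_filter_dvd P N
  have hsecond := sum_card_filter_dvd_sq_le N hP
  set A : ℝ := ∑ p ∈ P, (1 / p : ℝ)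
  have hA : 0 ≤ A := sum_nonneg fun p _ => by positivity
  calc ∑ n ∈ Icc 1 N, ((#{p ∈ P | p ∣ n} : ℝ) - A) ^ 2
      = ∑ n ∈ Icc 1 N, (#{p ∈ P | p ∣ n} : ℝ) ^ 2
          - 2 * A * ∑ n ∈ Icc 1 N, (#{p ∈ P | p ∣ n} : ℝ) + N * A ^ 2 := by
        simp_rw [sub_sq, sum_add_distrib, sum_sub_distrib, mul_sum, mul_right_comm _ _ A]
        simp
    _ ≤ N * A + 2 * A * #P := by
        linarith [mul_le_mul_of_nonneg_left hfirst hA]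

end TuranKubilius

theorem norm_sum_mul_le_of_sum_sq_le {ι : Type*} {s : Finset ι} {a b : ι → ℂ} {C : ℝ}
    (ha : ∀ n, ‖a n‖ ≤ 1) (hb : ∑ n ∈ s, ‖b n‖ ^ 2 ≤ #s * C) :
    ‖∑ n ∈ s, a n * b n‖ ≤ #s * √C := by
  have hsum : ‖∑ n ∈ s, a n * b n‖ ≤ ∑ n ∈ s, ‖b n‖ := norm_sum_le_of_le s fun n _ => by
    simpa using mul_le_mul_of_nonneg_right (ha n) (norm_nonneg (b n))
  calc ‖∑ n ∈ s, a n * b n‖ ≤ √((#s : ℝ) ^ 2 * C) := by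
        refine Real.le_sqrt_of_sq_le ?_
        calc ‖∑ n ∈ s, a n * b n‖ ^ 2 ≤ (∑ n ∈ s, ‖b n‖) ^ 2 := by gcongr
          _ ≤ #s * ∑ n ∈ s, ‖b n‖ ^ 2 := sq_sum_le_card_mul_sum_sq
          _ ≤ #s * (#s * C) := by gcongr
          _ = (#s : ℝ) ^ 2 * C := by ring
    _ = #s * √C := by rw [Real.sqrt_mul (sq_nonneg _), Real.sqrt_sq (Nat.cast_nonneg _)]

theorem sum_norm_sum_mul_sq_le {ι κ : Type*} (s : Finset ι) (t : Finset κ) {c : κ → ℂ}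
    (hc : ∀ k, ‖c k‖ ≤ 1) (G : κ → ι → ℂ) :
    ∑ i ∈ s, ‖∑ k ∈ t, c k * G k i‖ ^ 2 ≤
      ∑ k ∈ t, ∑ l ∈ t, ‖∑ i ∈ s, G k i * conj (G l i)‖ := by
  have hexpand : ((∑ i ∈ s, ‖∑ k ∈ t, c k * G k i‖ ^ 2 : ℝ) : ℂ) =
      ∑ k ∈ t, ∑ l ∈ t, c k * conj (c l) * ∑ i ∈ s, G k i * conj (G l i) := by
    push_cast
    simp_rw [← Complex.mul_conj', map_sum, sum_mul_sum, map_mul, mul_sum]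
    rw [sum_comm]
    refine sum_congr rfl fun k _ => ?_
    rw [sum_comm]
    exact sum_congr rfl fun l _ => sum_congr rfl fun i _ => by ring
  rw [← Complex.norm_of_nonneg (sum_nonneg fun i _ => sq_nonneg _), hexpand]
  refine norm_sum_le_of_le t fun k _ => norm_sum_le_of_le t fun l _ => ?_
  rw [norm_mul, norm_mul, RCLike.norm_conj]
  exact mul_le_of_le_one_left (norm_nonneg _) (mul_le_one₀ (hc k) (norm_nonneg _) (hc l))

section Katai

/-- The dilate `m ↦ F (p * m)` of the restriction of the sequence `F` to indices at most `N`. -/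
def truncDilate (F : ℕ → ℂ) (N p m : ℕ) : ℂ :=
  if p * m ≤ N then F (p * m) else 0

variable {F : ℕ → ℂ}

theorem sum_truncDilate_mul_conj {p q : ℕ} (hp : 0 < p) (N : ℕ) :
    ∑ m ∈ Icc 1 N, truncDilate F N p m * conj (truncDilate F N q m) =
      ∑ m ∈ Icc 1 (N / max p q), F (p * m) * conj (F (q * m)) := by
  rw [← sum_Icc_ite_mul_le _ (lt_max_of_lt_left hp)]
  refine sum_congr rfl fun m _ => ?_
  have hmax : max p q * m ≤ N ↔ p * m ≤ N ∧ q * m ≤ N := by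
    rw [max_mul_of_nonneg _ _ (Nat.zero_le m), max_le_iff]
  by_cases hpm : p * m ≤ N <;> by_cases hqm : q * m ≤ N <;> simp [truncDilate, hmax, hpm, hqm]

theorem norm_sum_truncDilate_mul_conj_self_le (hF : ∀ n, ‖F n‖ ≤ 1) {p : ℕ} (hp : 0 < p)
    (N : ℕ) : ‖∑ m ∈ Icc 1 N, truncDilate F N p m * conj (truncDilate F N p m)‖ ≤
      N * (1 / p) := by
  rw [sum_truncDilate_mul_conj hp, max_self]
  calc ‖∑ m ∈ Icc 1 (N / p), F (p * m) * conj (F (p * m))‖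
      ≤ ∑ _m ∈ Icc 1 (N / p), (1 : ℝ) := norm_sum_le_of_le _ fun _ _ => by
        rw [norm_mul, RCLike.norm_conj]
        exact mul_le_one₀ (hF _) (norm_nonneg _) (hF _)
    _ = (N / p : ℕ) := by simp
    _ ≤ N * (1 / p) := Nat.cast_div_le.trans_eq (mul_one_div _ _).symm

theorem eventually_norm_sum_truncDilate_mul_conj_le {p q : ℕ} (hp : 0 < p)
    (hpq : HasMean (fun n => F (p * n) * conj (F (q * n))) 0) {ε : ℝ} (hε : 0 < ε) :
    ∀ᶠ N : ℕ in atTop,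
      ‖∑ m ∈ Icc 1 N, truncDilate F N p m * conj (truncDilate F N q m)‖ ≤ N * ε := by
  have hdiv : Tendsto (fun N : ℕ => N / max p q) atTop atTop :=
    Nat.tendsto_div_const_atTop (lt_max_of_lt_left hp).ne'
  filter_upwards [hdiv.eventually (hasMean_zero_iff.1 hpq ε hε)] with N hN
  rw [sum_truncDilate_mul_conj hp, mul_comm]
  exact hN.trans (by gcongr; exact Nat.div_le_self _ _)

theorem eventually_sum_norm_sq_truncDilate_le (hF : ∀ n, ‖F n‖ ≤ 1) {P : Finset ℕ}
    (hP : ∀ p ∈ P, 0 < p)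
    (hcorr : ∀ p ∈ P, ∀ q ∈ P, p ≠ q → HasMean (fun n => F (p * n) * conj (F (q * n))) 0)
    {c : ℕ → ℂ} (hc : ∀ p, ‖c p‖ ≤ 1) {ε : ℝ} (hε : 0 < ε) :
    ∀ᶠ N : ℕ in atTop, ∑ m ∈ Icc 1 N, ‖∑ p ∈ P, c p * truncDilate F N p m‖ ^ 2 ≤
      N * (∑ p ∈ P, (1 / p : ℝ) + ε) := by
  set δ : ℝ := ε / ((#P : ℝ) ^ 2 + 1)
  have hδ : 0 < δ := by positivity
  have hoff : ∀ᶠ N : ℕ in atTop, ∀ p ∈ P, ∀ q ∈ P, p ≠ q →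
      ‖∑ m ∈ Icc 1 N, truncDilate F N p m * conj (truncDilate F N q m)‖ ≤ N * δ := by
    simp only [eventually_all_finset, eventually_imp_distrib_left]
    exact fun p hp q hq hpq =>
      eventually_norm_sum_truncDilate_mul_conj_le (hP p hp) (hcorr p hp q hq hpq) hδ
  filter_upwards [hoff] with N hN
  calc ∑ m ∈ Icc 1 N, ‖∑ p ∈ P, c p * truncDilate F N p m‖ ^ 2
      ≤ ∑ p ∈ P, ∑ q ∈ P,
          ‖∑ m ∈ Icc 1 N, truncDilate F N p m * conj (truncDilate F N q m)‖ :=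
        sum_norm_sum_mul_sq_le _ _ hc _
    _ ≤ ∑ p ∈ P, ∑ q ∈ P, ((if p = q then N * (1 / p : ℝ) else 0) + N * δ) := by
        refine sum_le_sum fun p hp => sum_le_sum fun q hq => ?_
        split_ifs with hpq
        · subst hpq
          exact le_add_of_le_of_nonneg
            (norm_sum_truncDilate_mul_conj_self_le hF (hP p hp) N) (by positivity)
        · simpa using hN p hp q hq hpq
    _ = N * ∑ p ∈ P, (1 / p : ℝ) + N * ((#P : ℝ) ^ 2 * δ) := by
        simp only [sum_add_distrib, sum_ite_eq, sum_const, nsmul_eq_mul, mul_sum]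
        congr 1
        · exact sum_congr rfl fun p hp => if_pos hp
        · ring
    _ ≤ N * (∑ p ∈ P, (1 / p : ℝ) + ε) := by
        rw [← mul_add]
        gcongr
        rw [mul_div_assoc', div_le_iff₀ (by positivity)]
        linarith

variable {ν : ArithmeticFunction ℂ}

theorem norm_map_prime_mul_sub_le (hν : ν.IsMultiplicative) (hν1 : ∀ n, ‖ν n‖ ≤ 1) {p : ℕ}
    (hp : p.Prime) (m : ℕ) : ‖ν (p * m) - ν p * ν m‖ ≤ if p ∣ m then 2 else 0 := by
  split_ifs with h
  · have hmul : ‖ν p * ν m‖ ≤ 1 := by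
      rw [norm_mul]
      exact mul_le_one₀ (hν1 p) (norm_nonneg _) (hν1 m)
    linarith [norm_sub_le (ν (p * m)) (ν p * ν m), hν1 (p * m)]
  · rw [hν.map_mul_of_coprime ((Nat.Prime.coprime_iff_not_dvd hp).2 h), sub_self, norm_zero]

theorem sum_mul_card_filter_dvd (g : ℕ → ℂ) {P : Finset ℕ} (hP : ∀ p ∈ P, 0 < p) (N : ℕ) :
    ∑ n ∈ Icc 1 N, g n * (#{p ∈ P | p ∣ n} : ℂ) =
      ∑ p ∈ P, ∑ m ∈ Icc 1 (N / p), g (p * m) := by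
  simp_rw [card_filter, Nat.cast_sum, mul_sum]
  rw [sum_comm]
  refine sum_congr rfl fun p hp => ?_
  simp_rw [Nat.cast_ite, Nat.cast_one, Nat.cast_zero, mul_ite, mul_one, mul_zero]
  rw [← sum_filter, sum_Icc_filter_dvd _ (hP p hp)]

theorem norm_sum_mul_card_primeDivisors_sub_le (hF : ∀ n, ‖F n‖ ≤ 1) (hν : ν.IsMultiplicative)
    (hν1 : ∀ n, ‖ν n‖ ≤ 1) {P : Finset ℕ} (hP : ∀ p ∈ P, p.Prime) (N : ℕ) :
    ‖∑ n ∈ Icc 1 N, F n * ν n * (#{p ∈ P | p ∣ n} : ℂ) -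
      ∑ m ∈ Icc 1 N, ν m * ∑ p ∈ P, ν p * truncDilate F N p m‖ ≤
      N * (2 * ∑ p ∈ P, 1 / (p : ℝ) ^ 2) := by
  have hswap : ∑ m ∈ Icc 1 N, ν m * ∑ p ∈ P, ν p * truncDilate F N p m =
      ∑ p ∈ P, ∑ m ∈ Icc 1 (N / p), F (p * m) * (ν p * ν m) := by
    simp_rw [mul_sum]
    rw [sum_comm]
    refine sum_congr rfl fun p hp => ?_
    rw [← sum_Icc_ite_mul_le _ (hP p hp).pos]
    refine sum_congr rfl fun m _ => ?_
    rw [truncDilate, mul_ite, mul_ite, mul_zero, mul_zero]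
    congr 1
    ring
  rw [sum_mul_card_filter_dvd (fun n => F n * ν n) fun p hp => (hP p hp).pos, hswap,
    ← sum_sub_distrib, mul_left_comm, mul_sum, mul_sum]
  refine norm_sum_le_of_le P fun p hp => ?_
  rw [← sum_sub_distrib]
  calc ‖∑ m ∈ Icc 1 (N / p), (F (p * m) * ν (p * m) - F (p * m) * (ν p * ν m))‖
      ≤ ∑ m ∈ Icc 1 (N / p), (if p ∣ m then (2 : ℝ) else 0) :=
        norm_sum_le_of_le _ fun m _ => by
          rw [← mul_sub, norm_mul]
          exact (mul_le_of_le_one_left (norm_nonneg _) (hF _)).trans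
            (norm_map_prime_mul_sub_le hν hν1 (hP p hp) m)
    _ = 2 * (N / (p * p) : ℕ) := by
        rw [← sum_filter, sum_const, card_Icc_filter_dvd, Nat.div_div_eq_div_mul,
          nsmul_eq_mul, mul_comm]
    _ ≤ 2 * (N * (1 / (p : ℝ) ^ 2)) := by
        gcongr
        exact Nat.cast_div_le.trans_eq (by push_cast; ring)

theorem exists_primes_sum_inv_gt (C : ℝ) :
    ∃ P : Finset ℕ, (∀ p ∈ P, p.Prime) ∧ C < ∑ p ∈ P, (1 / p : ℝ) := by
  by_contra! hbounded
  refine Nat.Primes.not_summable_one_div (summable_of_sum_le (c := C) (fun p => by positivity) ?_)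
  intro u
  have hprime : ∀ p ∈ u.map ⟨_, Nat.Primes.coe_nat_injective⟩, p.Prime := fun p hp => by
    obtain ⟨q, -, rfl⟩ := mem_map.1 hp
    exact q.2
  exact (sum_map u _ fun p : ℕ => (1 / p : ℝ)).ge.trans (hbounded _ hprime)

theorem sum_one_div_sq_le_tsum (P : Finset ℕ) :
    ∑ p ∈ P, 1 / (p : ℝ) ^ 2 ≤ ∑' n : ℕ, 1 / (n : ℝ) ^ 2 :=
  (Real.summable_one_div_nat_pow.2 one_lt_two).sum_le_tsum P fun n _ => by positivity

theorem norm_sum_mul_card_primeDivisors_sub_sum_inv_le {a : ℕ → ℂ} (ha : ∀ n, ‖a n‖ ≤ 1)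
    {P : Finset ℕ} (hP : ∀ p ∈ P, p.Prime) {N : ℕ} (hN : 2 * #P ≤ N) :
    ‖∑ n ∈ Icc 1 N, a n * (#{p ∈ P | p ∣ n} - (∑ p ∈ P, (1 / p : ℝ) : ℝ))‖ ≤
      N * √(2 * ∑ p ∈ P, (1 / p : ℝ)) := by
  have hturan := sum_card_primeDivisors_sub_sq_le N hP
  set A : ℝ := ∑ p ∈ P, (1 / p : ℝ)
  have hA : 0 ≤ A := sum_nonneg fun p _ => by positivity
  have hN' : 2 * (#P : ℝ) ≤ N := by exact_mod_cast hN
  have hnorm : ∀ n, ‖(#{p ∈ P | p ∣ n} - A : ℂ)‖ ^ 2 = ((#{p ∈ P | p ∣ n} : ℝ) - A) ^ 2 :=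
    fun n => by
      rw [← Complex.ofReal_natCast, ← Complex.ofReal_sub, Complex.norm_real, Real.norm_eq_abs,
        sq_abs]
  have hsq : ∑ n ∈ Icc 1 N, ‖(#{p ∈ P | p ∣ n} - A : ℂ)‖ ^ 2 ≤ N * (2 * A) := by
    simp_rw [hnorm]
    nlinarith
  simpa only [Nat.card_Icc, Nat.add_sub_cancel] using
    norm_sum_mul_le_of_sum_sq_le (s := Icc 1 N) ha (by simpa using hsq)

theorem eventually_sum_inv_mul_norm_sum_le (hF : ∀ n, ‖F n‖ ≤ 1) (hν : ν.IsMultiplicative)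
    (hν1 : ∀ n, ‖ν n‖ ≤ 1) {P : Finset ℕ} (hP : ∀ p ∈ P, p.Prime)
    (hA : 0 < ∑ p ∈ P, (1 / p : ℝ))
    (hcorr : ∀ p ∈ P, ∀ q ∈ P, p ≠ q → HasMean (fun n => F (p * n) * conj (F (q * n))) 0) :
    ∀ᶠ N : ℕ in atTop, (∑ p ∈ P, (1 / p : ℝ)) * ‖∑ n ∈ Icc 1 N, F n * ν n‖ ≤
      N * (2 * ∑' n : ℕ, 1 / (n : ℝ) ^ 2 + 2 * √(2 * ∑ p ∈ P, (1 / p : ℝ))) := by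
  filter_upwards [eventually_ge_atTop (2 * #P),
    eventually_sum_norm_sq_truncDilate_le hF (fun p hp => (hP p hp).pos) hcorr hν1 hA]
    with N hN hdilates
  have hFν : ∀ n, ‖F n * ν n‖ ≤ 1 := fun n => by
    rw [norm_mul]
    exact mul_le_one₀ (hF n) (norm_nonneg _) (hν1 n)
  have hS₂ := norm_sum_mul_card_primeDivisors_sub_sum_inv_le hFν hP hN
  have hswap := norm_sum_mul_card_primeDivisors_sub_le hF hν hν1 hP N
  set A : ℝ := ∑ p ∈ P, (1 / p : ℝ)
  set S := ∑ n ∈ Icc 1 N, F n * ν n * (#{p ∈ P | p ∣ n} : ℂ)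
  set S₁ := ∑ m ∈ Icc 1 N, ν m * ∑ p ∈ P, ν p * truncDilate F N p m
  set S₂ := ∑ n ∈ Icc 1 N, F n * ν n * (#{p ∈ P | p ∣ n} - (A : ℂ)) with hS₂def
  have hS₁ : ‖S₁‖ ≤ N * √(2 * A) := by
    simpa only [Nat.card_Icc, Nat.add_sub_cancel] using
      norm_sum_mul_le_of_sum_sq_le (s := Icc 1 N) hν1 (by simpa [two_mul] using hdilates)
  have hdecomp : A * ∑ n ∈ Icc 1 N, F n * ν n = (S - S₁) + S₁ - S₂ := by
    simp only [hS₂def, mul_sub, sum_sub_distrib, ← sum_mul, S]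
    ring
  calc A * ‖∑ n ∈ Icc 1 N, F n * ν n‖ = ‖(S - S₁) + S₁ - S₂‖ := by
        rw [← hdecomp, norm_mul, Complex.norm_of_nonneg hA.le]
    _ ≤ N * (2 * ∑ p ∈ P, 1 / (p : ℝ) ^ 2) + N * √(2 * A) + N * √(2 * A) :=
        norm_sub_le_of_le (norm_add_le_of_le hswap hS₁) hS₂
    _ ≤ N * (2 * ∑' n : ℕ, 1 / (n : ℝ) ^ 2) + N * √(2 * A) + N * √(2 * A) := by
        gcongr
        exact sum_one_div_sq_le_tsum P
    _ = N * (2 * ∑' n : ℕ, 1 / (n : ℝ) ^ 2 + 2 * √(2 * A)) := by ring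

/-- The criterion of Kátai and of Bourgain, Sarnak and Ziegler. -/
theorem hasMean_mul_of_prime_correlations (hF : ∀ n, ‖F n‖ ≤ 1) (hν : ν.IsMultiplicative)
    (hν1 : ∀ n, ‖ν n‖ ≤ 1)
    (hcorr : ∀ p q : ℕ, p.Prime → q.Prime → p ≠ q →
      HasMean (fun n => F (p * n) * conj (F (q * n))) 0) :
    HasMean (fun n => F n * ν n) 0 := by
  refine hasMean_zero_iff.2 fun ε hε => ?_
  set B : ℝ := 2 * ∑' n : ℕ, 1 / (n : ℝ) ^ 2
  obtain ⟨P, hP, hPA⟩ := exists_primes_sum_inv_gt (max (2 * B / ε) (32 / ε ^ 2))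
  have hcorrP : ∀ p ∈ P, ∀ q ∈ P, p ≠ q → HasMean (fun n => F (p * n) * conj (F (q * n))) 0 :=
    fun p hp q hq hpq => hcorr p q (hP p hp) (hP q hq) hpq
  have hA : 0 < ∑ p ∈ P, (1 / p : ℝ) :=
    lt_trans (lt_max_of_lt_right (by positivity)) hPA
  filter_upwards [eventually_sum_inv_mul_norm_sum_le hF hν hν1 hP hA hcorrP] with N hN
  set A : ℝ := ∑ p ∈ P, (1 / p : ℝ)
  have hAB : 2 * B < A * ε := (div_lt_iff₀ hε).1 ((le_max_left _ _).trans_lt hPA)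
  have hAε : 32 < A * ε ^ 2 := (div_lt_iff₀ (by positivity)).1 ((le_max_right _ _).trans_lt hPA)
  have hsqrt : √(2 * A) ≤ A * ε / 4 := Real.sqrt_le_iff.2 ⟨by positivity, by nlinarith⟩
  refine le_of_mul_le_mul_left (hN.trans ?_) hA
  calc N * (B + 2 * √(2 * A)) ≤ N * (A * ε) := by gcongr; linarith
    _ = A * (ε * N) := by ring

end Katai

section Fourier

theorem fourier_mul_exp_eq (φ : ℝ → ℂ) (y u : ℝ) :
    𝓕 (fun t => φ t * Complex.exp (↑(2 * Real.pi * t * y) * Complex.I)) u = 𝓕 φ (u - y) := by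
  simp only [Real.fourier_real_eq_integral_exp_smul, smul_eq_mul]
  congr with t
  rw [mul_left_comm, ← Complex.exp_add, mul_comm (φ t)]
  congr 2
  push_cast
  ring

theorem fourier_comp_div_eq (φ : ℝ → ℂ) {c : ℝ} (hc : 0 < c) (u : ℝ) :
    𝓕 (fun t => φ (t / c)) u = c * 𝓕 φ (c * u) := by
  have hscale := Measure.integral_comp_div
    (fun t : ℝ => Complex.exp (↑(-2 * Real.pi * t * (c * u)) * Complex.I) • φ t) c
  rw [abs_of_pos hc, Complex.real_smul] at hscale
  rw [Real.fourier_real_eq_integral_exp_smul, Real.fourier_real_eq_integral_exp_smul, ← hscale]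
  congr with t
  congr 3
  push_cast
  have : (c : ℂ) ≠ 0 := by exact_mod_cast hc.ne'
  field_simp

theorem integral_fourier_mul_eq_integral_mul_fourier {f g : ℝ → ℂ} (hf : Integrable f)
    (hg : Integrable g) : ∫ t, 𝓕 f t * g t = ∫ u, f u * 𝓕 g u := by
  simpa using! (VectorFourier.integral_fourierIntegral_smul_eq_flip (L := innerₗ ℝ)
    Real.continuous_fourierChar continuous_inner hf hg)

theorem exists_hasCompactSupport_integral_fourier_eq_one :
    ∃ φ : ℝ → ℂ, Continuous φ ∧ HasCompactSupport φ ∧ Integrable (𝓕 φ) ∧ ∫ v, 𝓕 φ v = 1 := by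
  obtain ⟨b⟩ : Nonempty (ContDiffBump (0 : ℝ)) := inferInstance
  let φ : ℝ → ℂ := fun t => (b t : ℂ)
  have hφs : ContDiff ℝ ((⊤ : ℕ∞) : WithTop ℕ∞) φ := Complex.ofRealCLM.contDiff.comp b.contDiff
  have hφc : HasCompactSupport φ :=
    b.hasCompactSupport.comp_left (g := fun x : ℝ => (x : ℂ)) Complex.ofReal_zero
  have hK : Integrable (𝓕 φ) := (𝓕 (hφc.toSchwartzMap hφs)).integrable
  refine ⟨φ, hφs.continuous, hφc, hK, ?_⟩
  have hinv := congrFun (hφs.continuous.fourierInv_fourier_eq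
    (hφs.continuous.integrable_of_hasCompactSupport hφc) hK) 0
  rw [Real.fourierInv_eq] at hinv
  simpa [φ, b.one_of_mem_closedBall (Metric.mem_closedBall_self b.rIn_pos.le)] using hinv

end Fourier

section Tauberian

variable {m : ℝ → ℂ} {C : ℝ} {Φ : ℝ → ℝ → ℂ}

theorem integrable_mul_exp_neg (hm : Measurable m) (hmC : ∀ u, ‖m u‖ ≤ C)
    (hm0 : ∀ u < 0, m u = 0) {δ : ℝ} (hδ : 0 < δ) :
    Integrable fun u => m u * (Real.exp (-δ * u) : ℂ) := by
  rw [← integrableOn_univ, ← Set.Iio_union_Ici (a := (0 : ℝ))]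
  refine IntegrableOn.union ?_ ?_
  · exact integrableOn_zero.congr_fun (fun u hu => by simp [hm0 u hu]) measurableSet_Iio
  · rw [integrableOn_Ici_iff_integrableOn_Ioi]
    exact Integrable.bdd_mul (c := C) (integrableOn_exp_mul_Ioi (by linarith) 0).ofReal
      hm.aestronglyMeasurable (Eventually.of_forall hmC)

theorem norm_mul_exp_neg_le (hmC : ∀ u, ‖m u‖ ≤ C) (hm0 : ∀ u < 0, m u = 0) {δ : ℝ}
    (hδ : 0 < δ) (u : ℝ) : ‖m u * (Real.exp (-δ * u) : ℂ)‖ ≤ C := by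
  rcases lt_or_ge u 0 with hu | hu
  · simpa [hm0 u hu] using (norm_nonneg _).trans (hmC u)
  · rw [norm_mul, Complex.norm_real, Real.norm_eq_abs, Real.abs_exp]
    refine (mul_le_of_le_one_right (norm_nonneg _) (Real.exp_le_one_iff.2 ?_)).trans (hmC u)
    nlinarith

theorem tendsto_integral_mul_exp_neg_mul (hm : Measurable m) (hmC : ∀ u, ‖m u‖ ≤ C)
    (hm0 : ∀ u < 0, m u = 0) {K : ℝ → ℂ} (hK : Integrable K) :
    Tendsto (fun δ : ℝ => ∫ u, m u * (Real.exp (-δ * u) : ℂ) * K u) (𝓝[>] 0)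
      (𝓝 (∫ u, m u * K u)) := by
  refine tendsto_integral_filter_of_dominated_convergence (fun u => C * ‖K u‖) ?_ ?_
    (hK.norm.const_mul C) ?_
  · exact Eventually.of_forall fun δ =>
      (hm.mul (by fun_prop)).aestronglyMeasurable.mul hK.aestronglyMeasurable
  · filter_upwards [self_mem_nhdsWithin] with δ hδ
    refine Eventually.of_forall fun u => ?_
    rw [norm_mul]
    exact mul_le_mul_of_nonneg_right (norm_mul_exp_neg_le hmC hm0 hδ u) (norm_nonneg _)
  · refine Eventually.of_forall fun u => ?_
    have hcont : Continuous fun δ : ℝ => m u * (Real.exp (-δ * u) : ℂ) * K u := by fun_prop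
    simpa using (hcont.tendsto 0).mono_left (nhdsWithin_le_nhds (s := Set.Ioi 0))

theorem tendsto_integral_mul_of_hasCompactSupport
    (hΦ : ContinuousOn (Function.uncurry Φ) (Set.Ici 0 ×ˢ Set.univ)) {ψ : ℝ → ℂ}
    (hψ : Continuous ψ) (hψc : HasCompactSupport ψ) :
    Tendsto (fun δ => ∫ t, Φ δ t * ψ t) (𝓝[>] 0) (𝓝 (∫ t, Φ 0 t * ψ t)) := by
  have hcont : ContinuousOn (fun δ => ∫ t, Φ δ t * ψ t) (Set.Ici 0) :=
    continuousOn_integral_of_compact_support hψc (hΦ.mul (by fun_prop))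
      fun δ t _ ht => by rw [image_eq_zero_of_notMem_tsupport ht, mul_zero]
  exact (hcont 0 Set.self_mem_Ici).mono_left (nhdsWithin_mono 0 Set.Ioi_subset_Ici_self)

theorem integral_mul_fourier_eq_of_continuousOn (hm : Measurable m) (hmC : ∀ u, ‖m u‖ ≤ C)
    (hm0 : ∀ u < 0, m u = 0) (hΦ : ContinuousOn (Function.uncurry Φ) (Set.Ici 0 ×ˢ Set.univ))
    (hmΦ : ∀ δ > 0, ∀ t, 𝓕 (fun u => m u * (Real.exp (-δ * u) : ℂ)) t = Φ δ t) {ψ : ℝ → ℂ}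
    (hψ : Continuous ψ) (hψc : HasCompactSupport ψ) (hK : Integrable (𝓕 ψ)) :
    ∫ u, m u * 𝓕 ψ u = ∫ t, Φ 0 t * ψ t := by
  refine tendsto_nhds_unique (tendsto_integral_mul_exp_neg_mul hm hmC hm0 hK)
    ((tendsto_integral_mul_of_hasCompactSupport hΦ hψ hψc).congr' ?_)
  filter_upwards [self_mem_nhdsWithin] with δ hδ
  rw [← integral_fourier_mul_eq_integral_mul_fourier (integrable_mul_exp_neg hm hmC hm0 hδ)
    (hψ.integrable_of_hasCompactSupport hψc)]
  simp_rw [hmΦ δ hδ]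

theorem tendsto_integral_mul_fourier_translate (hm : Measurable m) (hmC : ∀ u, ‖m u‖ ≤ C)
    (hm0 : ∀ u < 0, m u = 0) (hΦ : ContinuousOn (Function.uncurry Φ) (Set.Ici 0 ×ˢ Set.univ))
    (hmΦ : ∀ δ > 0, ∀ t, 𝓕 (fun u => m u * (Real.exp (-δ * u) : ℂ)) t = Φ δ t) {φ : ℝ → ℂ}
    (hφ : Continuous φ) (hφc : HasCompactSupport φ) (hK : Integrable (𝓕 φ)) :
    Tendsto (fun y => ∫ u, m u * 𝓕 φ (u - y)) atTop (𝓝 0) := by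
  have hRL := (Real.zero_at_infty_fourier fun t => Φ 0 t * φ t).comp
    (tendsto_neg_atTop_atBot.mono_right atBot_le_cocompact)
  refine hRL.congr fun y => ?_
  have htranslate := fourier_mul_exp_eq φ y
  have hflip := integral_mul_fourier_eq_of_continuousOn hm hmC hm0 hΦ hmΦ
    (ψ := fun t => φ t * Complex.exp (↑(2 * Real.pi * t * y) * Complex.I)) (by fun_prop)
    hφc.mul_right (by simpa only [funext htranslate] using hK.comp_sub_right y)
  simp only [htranslate] at hflip
  rw [hflip, Function.comp_apply, Real.fourier_real_eq_integral_exp_smul]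
  congr with t
  rw [smul_eq_mul, mul_comm, mul_assoc]
  congr 3
  push_cast
  ring

theorem tendsto_integral_comp_add_div_mul_fourier (hm : Measurable m) (hmC : ∀ u, ‖m u‖ ≤ C)
    (hm0 : ∀ u < 0, m u = 0) (hΦ : ContinuousOn (Function.uncurry Φ) (Set.Ici 0 ×ˢ Set.univ))
    (hmΦ : ∀ δ > 0, ∀ t, 𝓕 (fun u => m u * (Real.exp (-δ * u) : ℂ)) t = Φ δ t) {φ : ℝ → ℂ}
    (hφ : Continuous φ) (hφc : HasCompactSupport φ) (hK : Integrable (𝓕 φ)) {c : ℝ}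
    (hc : 0 < c) :
    Tendsto (fun y => ∫ v, m (y + v / c) * 𝓕 φ v) atTop (𝓝 0) := by
  have hdilate : 𝓕 (fun t => φ (t / c)) = fun u => (c : ℂ) * 𝓕 φ (c * u) :=
    funext fun u => fourier_comp_div_eq φ hc u
  refine (tendsto_integral_mul_fourier_translate hm hmC hm0 hΦ hmΦ
    (φ := fun t => φ (t / c)) (by fun_prop)
    (hφc.comp_homeomorph (Homeomorph.mulRight₀ c⁻¹ (inv_ne_zero hc.ne')))
    (by rw [hdilate]; exact (hK.comp_mul_left' hc.ne').const_mul _)).congr fun y => ?_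
  have hc' : (c : ℂ) ≠ 0 := by exact_mod_cast hc.ne'
  calc ∫ u, m u * 𝓕 (fun t => φ (t / c)) (u - y)
      = ∫ u, (c : ℂ) * (m (y + c * (u - y) / c) * 𝓕 φ (c * (u - y))) := by
        congr with u
        rw [hdilate, mul_div_cancel_left₀ _ hc.ne', add_sub_cancel, mul_left_comm]
    _ = ∫ u, (c : ℂ) * (m (y + c * u / c) * 𝓕 φ (c * u)) :=
        integral_sub_right_eq_self (fun u => (c : ℂ) * (m (y + c * u / c) * 𝓕 φ (c * u))) y
    _ = ∫ v, m (y + v / c) * 𝓕 φ v := by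
        rw [integral_const_mul,
          Measure.integral_comp_mul_left (fun v => m (y + v / c) * 𝓕 φ v) c,
          abs_of_pos (inv_pos.2 hc), Complex.real_smul, Complex.ofReal_inv,
          mul_inv_cancel_left₀ hc']

theorem integrable_min_abs_mul_norm {ω : ℝ → ℝ} (hω : Continuous ω) (hC : 0 ≤ C) {K : ℝ → ℂ}
    (hK : Integrable K) : Integrable fun v => min |ω v| C * ‖K v‖ :=
  hK.norm.bdd_mul (c := C) (Continuous.aestronglyMeasurable (by fun_prop))
    (Eventually.of_forall fun v => by
      rw [Real.norm_of_nonneg (le_min (abs_nonneg _) hC)]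
      exact min_le_right _ _)

theorem tendsto_integral_min_abs_comp_div_mul_norm {ω : ℝ → ℝ} (hω : Continuous ω)
    (hω0 : ω 0 = 0) (hC : 0 ≤ C) {K : ℝ → ℂ} (hK : Integrable K) :
    Tendsto (fun c : ℝ => ∫ v, min |ω (v / c)| C * ‖K v‖) atTop (𝓝 0) := by
  rw [← integral_zero ℝ ℝ]
  refine tendsto_integral_filter_of_dominated_convergence (fun v => C * ‖K v‖) ?_ ?_
    (hK.norm.const_mul C) ?_
  · exact Eventually.of_forall fun c =>
      (integrable_min_abs_mul_norm (by fun_prop) hC hK).aestronglyMeasurable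
  · refine Eventually.of_forall fun c => Eventually.of_forall fun v => ?_
    rw [norm_mul, norm_norm, Real.norm_of_nonneg (le_min (abs_nonneg _) hC)]
    exact mul_le_mul_of_nonneg_right (min_le_right _ _) (norm_nonneg _)
  · refine Eventually.of_forall fun v => ?_
    have hdiv : Tendsto (fun c : ℝ => v / c) atTop (𝓝 0) :=
      tendsto_const_nhds.div_atTop tendsto_id
    have hcont : Continuous fun x => min |ω x| C * ‖K v‖ := by fun_prop
    simpa [hω0, hC, Function.comp_def] using (hcont.tendsto 0).comp hdiv

theorem norm_integral_comp_add_div_mul_sub_le (hm : Measurable m) (hmC : ∀ u, ‖m u‖ ≤ C)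
    {ω r : ℝ → ℝ} (hω : Continuous ω) (hslow : ∀ y w, ‖m (y + w) - m y‖ ≤ ω w + r y)
    {K : ℝ → ℂ} (hK : Integrable K) (hK1 : ∫ v, K v = 1) (c y : ℝ) :
    ‖(∫ v, m (y + v / c) * K v) - m y‖ ≤
      (∫ v, min |ω (v / c)| (2 * C) * ‖K v‖) + |r y| * ∫ v, ‖K v‖ := by
  have hC : 0 ≤ C := (norm_nonneg _).trans (hmC 0)
  have hmint : Integrable fun v => m (y + v / c) * K v :=
    hK.bdd_mul (c := C) (hm.comp (by fun_prop)).aestronglyMeasurable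
      (Eventually.of_forall fun v => hmC _)
  have hωint := integrable_min_abs_mul_norm (C := 2 * C) (ω := fun v => ω (v / c))
    (by fun_prop) (by positivity) hK
  have hpointwise : ∀ v, ‖m (y + v / c) - m y‖ ≤ min |ω (v / c)| (2 * C) + |r y| := by
    intro v
    rw [← min_add_add_right]
    refine le_min ((hslow y _).trans (add_le_add (le_abs_self _) (le_abs_self _))) ?_
    linarith [norm_sub_le (m (y + v / c)) (m y), hmC (y + v / c), hmC y, abs_nonneg (r y)]
  calc ‖(∫ v, m (y + v / c) * K v) - m y‖ = ‖∫ v, (m (y + v / c) - m y) * K v‖ := by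
        simp_rw [sub_mul]
        rw [integral_sub hmint (hK.const_mul _), integral_const_mul, hK1, mul_one]
    _ ≤ ∫ v, (min |ω (v / c)| (2 * C) * ‖K v‖ + |r y| * ‖K v‖) := by
        refine norm_integral_le_of_norm_le (hωint.add (hK.norm.const_mul _))
          (Eventually.of_forall fun v => ?_)
        rw [norm_mul, ← add_mul]
        exact mul_le_mul_of_nonneg_right (hpointwise v) (norm_nonneg _)
    _ = _ := by rw [integral_add hωint (hK.norm.const_mul _), integral_const_mul]

/-- As in the Wiener–Ikehara theorem, averages of `m` against a kernel with compactly supported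
Fourier transform decay by the Riemann–Lebesgue lemma, and slow oscillation removes the
averaging. -/
theorem tendsto_zero_of_slowly_oscillating (hm : Measurable m) (hmC : ∀ u, ‖m u‖ ≤ C)
    (hm0 : ∀ u < 0, m u = 0) (hΦ : ContinuousOn (Function.uncurry Φ) (Set.Ici 0 ×ˢ Set.univ))
    (hmΦ : ∀ δ > 0, ∀ t, 𝓕 (fun u => m u * (Real.exp (-δ * u) : ℂ)) t = Φ δ t)
    {ω r : ℝ → ℝ} (hω : Continuous ω) (hω0 : ω 0 = 0) (hr : Tendsto r atTop (𝓝 0))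
    (hslow : ∀ y w, ‖m (y + w) - m y‖ ≤ ω w + r y) :
    Tendsto m atTop (𝓝 0) := by
  obtain ⟨φ, hφ, hφc, hK, hK1⟩ := exists_hasCompactSupport_integral_fourier_eq_one
  have hC : 0 ≤ 2 * C := mul_nonneg zero_le_two ((norm_nonneg _).trans (hmC 0))
  rw [Metric.nhds_basis_ball.tendsto_right_iff]
  intro ε hε
  obtain ⟨c, hcω, hc⟩ := (((tendsto_integral_min_abs_comp_div_mul_norm hω hω0 hC
    hK).eventually_lt_const (show 0 < ε / 3 by positivity)).and (eventually_gt_atTop 0)).exists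
  have hrK : Tendsto (fun y => |r y| * ∫ v, ‖𝓕 φ v‖) atTop (𝓝 0) := by
    simpa using hr.abs.mul_const (∫ v, ‖𝓕 φ v‖)
  have hsmooth := tendsto_integral_comp_add_div_mul_fourier hm hmC hm0 hΦ hmΦ hφ hφc hK hc
  filter_upwards [hsmooth.norm.eventually_lt_const (show ‖(0 : ℂ)‖ < ε / 3 by simp [hε]),
    hrK.eventually_lt_const (show 0 < ε / 3 by positivity)] with y hy hry
  have herror := norm_integral_comp_add_div_mul_sub_le hm hmC hω hslow hK hK1 c y
  have htriangle := norm_sub_norm_le (m y) (∫ v, m (y + v / c) * 𝓕 φ v)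
  rw [norm_sub_rev] at htriangle
  rw [mem_ball_zero_iff]
  linarith

end Tauberian

section Mertens

theorem norm_moebius_le_one (n : ℕ) : ‖(ArithmeticFunction.moebius n : ℂ)‖ ≤ 1 := by
  rw [Complex.norm_intCast]
  exact_mod_cast ArithmeticFunction.abs_moebius_le_one

/-- Mertens' function, the summatory function of the Möbius function. -/
noncomputable def mertens (x : ℝ) : ℂ := ∑ n ∈ Icc 1 ⌊x⌋₊, (ArithmeticFunction.moebius n : ℂ)

theorem norm_mertens_le {x : ℝ} (hx : 0 ≤ x) : ‖mertens x‖ ≤ x := by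
  refine (norm_sum_le_of_le _ fun n _ => norm_moebius_le_one n).trans ?_
  simpa using Nat.floor_le hx

theorem norm_mertens_sub_le {x y : ℝ} (hx : 0 ≤ x) (hy : 0 ≤ y) :
    ‖mertens y - mertens x‖ ≤ |y - x| + 1 := by
  wlog hxy : x ≤ y generalizing x y
  · rw [norm_sub_rev, abs_sub_comm]
    exact this hy hx (le_of_not_ge hxy)
  have hfloor : ⌊x⌋₊ ≤ ⌊y⌋₊ := Nat.floor_mono hxy
  have hsub : Icc 1 ⌊x⌋₊ ⊆ Icc 1 ⌊y⌋₊ := Icc_subset_Icc_right hfloor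
  rw [mertens, mertens, ← sum_sdiff hsub, add_sub_cancel_right, abs_of_nonneg (sub_nonneg.2 hxy)]
  refine (norm_sum_le_of_le _ fun n _ => norm_moebius_le_one n).trans ?_
  rw [sum_const, nsmul_one, card_sdiff_of_subset hsub, Nat.card_Icc, Nat.card_Icc,
    Nat.add_sub_cancel, Nat.add_sub_cancel, Nat.cast_sub hfloor]
  linarith [Nat.floor_le hy, Nat.lt_floor_add_one x]

theorem measurable_mertens : Measurable mertens :=
  (measurable_from_nat (f := fun k : ℕ => ∑ n ∈ Icc 1 k, (ArithmeticFunction.moebius n : ℂ))).comp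
    Nat.measurable_floor

/-- The function `1 / (s ζ(s))`, continuously extended to the pole of `ζ`. -/
noncomputable def invMulZeta : ℂ → ℂ := Function.update (fun s => 1 / (s * riemannZeta s)) 1 0

theorem continuousAt_invMulZeta {s : ℂ} (hs : 1 ≤ s.re) : ContinuousAt invMulZeta s := by
  unfold invMulZeta
  rcases eq_or_ne s 1 with rfl | hs1
  · rw [continuousAt_update_same]
    have hid : Tendsto (fun s : ℂ => s) (𝓝[≠] 1) (𝓝 1) := tendsto_id.mono_left nhdsWithin_le_nhds
    have hlim : Tendsto (fun s : ℂ => (s - 1) / (s * ((s - 1) * riemannZeta s))) (𝓝[≠] 1)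
        (𝓝 ((1 - 1) / (1 * 1))) :=
      (hid.sub_const 1).div (hid.mul riemannZeta_residue_one) (by simp)
    simp only [sub_self, zero_div] at hlim
    refine hlim.congr' ?_
    filter_upwards [self_mem_nhdsWithin] with s hs
    rw [mul_left_comm, div_mul_eq_div_div, div_self (sub_ne_zero.2 hs)]
  · have hs0 : s ≠ 0 := by rintro rfl; norm_num at hs
    rw [continuousAt_update_of_ne hs1]
    exact continuousAt_const.div
      (continuousAt_id.mul (differentiableAt_riemannZeta hs1).continuousAt)
      (mul_ne_zero hs0 (riemannZeta_ne_zero_of_one_le_re hs))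

theorem integral_mertens_mul_cpow_eq {s : ℂ} (hs : 1 < s.re) :
    ∫ t in Set.Ioi (1 : ℝ), mertens t * (t : ℂ) ^ (-(s + 1)) = invMulZeta s := by
  have hs1 : s ≠ 1 := by rintro rfl; simp at hs
  have hs0 : s ≠ 0 := by rintro rfl; norm_num at hs
  have hbound : (fun N : ℕ => ∑ n ∈ Icc 1 N, ‖(ArithmeticFunction.moebius n : ℂ)‖) =O[atTop]
      fun N => (N : ℝ) ^ (1 : ℝ) := by
    simp only [Real.rpow_one]
    refine Asymptotics.isBigO_of_le _ fun N => ?_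
    rw [Real.norm_of_nonneg (sum_nonneg fun _ _ => norm_nonneg _), Real.norm_natCast]
    exact (sum_le_sum fun n _ => norm_moebius_le_one n).trans (by simp)
  have hL : LSeries (fun n => (ArithmeticFunction.moebius n : ℂ)) s =
      s * ∫ t in Set.Ioi (1 : ℝ), mertens t * (t : ℂ) ^ (-(s + 1)) :=
    LSeries_eq_mul_integral' _ zero_le_one hs hbound
  have hζ := ArithmeticFunction.LSeries_zeta_mul_Lseries_moebius hs
  rw [ArithmeticFunction.LSeries_zeta_eq_riemannZeta hs, hL] at hζ
  rw [invMulZeta, Function.update_of_ne hs1,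
    eq_div_iff (mul_ne_zero hs0 (left_ne_zero_of_mul_eq_one hζ))]
  linear_combination hζ

/-- Mertens' function on an exponential scale, normalised to be bounded: `M(eᵘ) e⁻ᵘ`. -/
noncomputable def mertensExp (u : ℝ) : ℂ := mertens (Real.exp u) * (Real.exp (-u) : ℂ)

theorem measurable_mertensExp : Measurable mertensExp :=
  (measurable_mertens.comp Real.measurable_exp).mul (by fun_prop)

theorem mertensExp_eq_zero {u : ℝ} (hu : u < 0) : mertensExp u = 0 := by
  have : ⌊Real.exp u⌋₊ = 0 := Nat.floor_eq_zero.2 (Real.exp_lt_one_iff.2 hu)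
  simp [mertensExp, mertens, this]

theorem norm_mertensExp_le (u : ℝ) : ‖mertensExp u‖ ≤ 1 := by
  rw [mertensExp, norm_mul, Complex.norm_real, Real.norm_eq_abs, Real.abs_exp]
  calc ‖mertens (Real.exp u)‖ * Real.exp (-u) ≤ Real.exp u * Real.exp (-u) :=
        mul_le_mul_of_nonneg_right (norm_mertens_le (Real.exp_pos _).le) (Real.exp_pos _).le
    _ = 1 := by rw [← Real.exp_add, add_neg_cancel, Real.exp_zero]

theorem norm_mertensExp_sub_le (y w : ℝ) :
    ‖mertensExp (y + w) - mertensExp y‖ ≤ 2 * |Real.exp w - 1| + Real.exp (-y) := by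
  have hsplit : mertensExp (y + w) - mertensExp y =
      mertens (Real.exp (y + w)) * ((Real.exp (-(y + w)) - Real.exp (-y) : ℝ) : ℂ) +
      (mertens (Real.exp (y + w)) - mertens (Real.exp y)) * (Real.exp (-y) : ℂ) := by
    unfold mertensExp
    push_cast
    ring
  have hscale : ‖mertens (Real.exp (y + w))‖ * |Real.exp (-(y + w)) - Real.exp (-y)| ≤
      |Real.exp w - 1| := by
    refine (mul_le_mul_of_nonneg_right (norm_mertens_le (Real.exp_pos _).le)
      (abs_nonneg _)).trans ?_
    rw [← abs_of_pos (Real.exp_pos (y + w)), ← abs_mul, mul_sub,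
      ← Real.exp_add, ← Real.exp_add, abs_sub_comm]
    simp
  have hincrement : ‖mertens (Real.exp (y + w)) - mertens (Real.exp y)‖ * Real.exp (-y) ≤
      |Real.exp w - 1| + Real.exp (-y) := by
    refine (mul_le_mul_of_nonneg_right (norm_mertens_sub_le (Real.exp_pos _).le
      (Real.exp_pos _).le) (Real.exp_pos _).le).trans ?_
    rw [add_mul, one_mul, ← abs_of_pos (Real.exp_pos (-y)), ← abs_mul, sub_mul,
      ← Real.exp_add, ← Real.exp_add]
    simp
  rw [hsplit]
  refine (norm_add_le _ _).trans ?_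
  rw [norm_mul, norm_mul, Complex.norm_real, Complex.norm_real, Real.norm_eq_abs, Real.norm_eq_abs,
    Real.abs_exp]
  linarith

theorem fourier_mertensExp_mul_exp_neg {δ : ℝ} (hδ : 0 < δ) (t : ℝ) :
    𝓕 (fun u => mertensExp u * (Real.exp (-δ * u) : ℂ)) t =
      invMulZeta (1 + δ + 2 * Real.pi * t * Complex.I) := by
  set s : ℂ := 1 + δ + 2 * Real.pi * t * Complex.I with hs
  have hre : 1 < s.re := by simpa [hs] using hδ
  have hsubst := integral_comp_exp_Ioi (fun x : ℝ => mertens x * (x : ℂ) ^ (-(s + 1))) 0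
  rw [Real.exp_zero] at hsubst
  rw [← integral_mertens_mul_cpow_eq hre, ← hsubst, Real.fourier_real_eq_integral_exp_smul,
    ← setIntegral_eq_integral_of_forall_compl_eq_zero (s := Set.Ici (0 : ℝ)),
    integral_Ici_eq_integral_Ioi]
  · refine setIntegral_congr_fun measurableSet_Ioi fun u _ => ?_
    have hcpow : ((Real.exp u : ℝ) : ℂ) ^ (-(s + 1)) = Complex.exp (-(s + 1) * u) := by
      rw [Complex.cpow_def_of_ne_zero (by exact_mod_cast (Real.exp_pos u).ne'),
        ← Complex.ofReal_log (Real.exp_pos u).le, Real.log_exp, mul_comm]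
    have hexp : Complex.exp (-2 * Real.pi * u * t * Complex.I) * Complex.exp (-u) *
        Complex.exp (-δ * u) = Complex.exp u * Complex.exp (-(s + 1) * u) := by
      rw [← Complex.exp_add, ← Complex.exp_add, ← Complex.exp_add, hs]
      congr 1
      ring
    simp only [smul_eq_mul, Complex.real_smul, hcpow, mertensExp]
    push_cast
    linear_combination mertens (Real.exp u) * hexp
  · intro u hu
    rw [mertensExp_eq_zero (by simpa using hu), zero_mul, smul_zero]

theorem tendsto_mertensExp : Tendsto mertensExp atTop (𝓝 0) := by
  refine tendsto_zero_of_slowly_oscillating measurable_mertensExp norm_mertensExp_le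
    (fun _ => mertensExp_eq_zero) (Φ := fun δ t => invMulZeta (1 + δ + 2 * Real.pi * t * Complex.I))
    (fun p hp => ContinuousAt.continuousWithinAt ?_) (fun _ => fourier_mertensExp_mul_exp_neg)
    (by fun_prop) (by simp) Real.tendsto_exp_neg_atTop_nhds_zero norm_mertensExp_sub_le
  have hcont : ContinuousAt invMulZeta (1 + p.1 + 2 * Real.pi * p.2 * Complex.I) :=
    continuousAt_invMulZeta (by simpa using hp.1)
  exact ContinuousAt.comp (f := fun p : ℝ × ℝ => (1 + p.1 + 2 * Real.pi * p.2 * Complex.I : ℂ))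
    hcont (by fun_prop)

theorem hasMean_moebius : HasMean (fun n => (ArithmeticFunction.moebius n : ℂ)) 0 := by
  refine (tendsto_mertensExp.comp
    (Real.tendsto_log_atTop.comp tendsto_natCast_atTop_atTop)).congr' ?_
  filter_upwards [eventually_gt_atTop 0] with N hN
  simp only [Function.comp_apply, mertensExp, mertens, Real.exp_neg,
    Real.exp_log (Nat.cast_pos.2 hN), Nat.floor_natCast]
  push_cast
  ring

end Mertens

section VanDerCorput

theorem sum_Icc_one_eq_sum_range {E : Type*} [AddCommMonoid E] (g : ℕ → E) (N : ℕ) :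
    ∑ n ∈ Icc 1 N, g n = ∑ n ∈ range N, g (n + 1) := by
  rw [range_eq_Ico, sum_Ico_add' g 0 N 1]
  rfl

variable {v : ℕ → ℂ}

theorem norm_sum_Icc_shift_sub_le (hv : ∀ n, ‖v n‖ ≤ 1) (N s : ℕ) :
    ‖∑ n ∈ Icc 1 N, v (n + s) - ∑ n ∈ Icc 1 N, v n‖ ≤ 2 * s := by
  induction s with
  | zero => simp
  | succ s ih =>
    have htelescope : ∑ n ∈ Icc 1 N, v (n + (s + 1)) - ∑ n ∈ Icc 1 N, v (n + s) =
        v (N + 1 + s) - v (0 + 1 + s) := by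
      rw [← sum_sub_distrib, sum_Icc_one_eq_sum_range, ← sum_range_sub fun n => v (n + 1 + s)]
      exact sum_congr rfl fun n _ => by congr 2; ring
    have hstep : ‖v (N + 1 + s) - v (0 + 1 + s)‖ ≤ 2 :=
      (norm_sub_le _ _).trans (by linarith [hv (N + 1 + s), hv (0 + 1 + s)])
    rw [← htelescope] at hstep
    push_cast
    linarith [norm_sub_le_norm_sub_add_norm_sub (∑ n ∈ Icc 1 N, v (n + (s + 1)))
      (∑ n ∈ Icc 1 N, v (n + s)) (∑ n ∈ Icc 1 N, v n)]

theorem HasMean.shift {l : ℂ} (h : HasMean v l) (hv : ∀ n, ‖v n‖ ≤ 1) (s : ℕ) :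
    HasMean (fun n => v (n + s)) l := by
  have hdiff : HasMean (fun n => v (n + s) - v n) 0 := hasMean_zero_iff.2 fun ε hε => by
    filter_upwards [eventually_ge_atTop ⌈2 * s / ε⌉₊] with N hN
    rw [sum_sub_distrib]
    refine (norm_sum_Icc_shift_sub_le hv N s).trans ?_
    rw [mul_comm ε, ← div_le_iff₀ hε]
    exact Nat.ceil_le.1 hN
  simpa using hdiff.add h

theorem norm_mul_conj_le_one {a b : ℂ} (ha : ‖a‖ ≤ 1) (hb : ‖b‖ ≤ 1) : ‖a * conj b‖ ≤ 1 := by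
  rw [norm_mul, RCLike.norm_conj]
  exact mul_le_one₀ ha (norm_nonneg _) hb

theorem norm_sum_sum_shift_sub_le (hv : ∀ n, ‖v n‖ ≤ 1) (N L d : ℕ) :
    ‖∑ n ∈ Icc 1 N, ∑ i ∈ range L, v (n + i * d) - L * ∑ n ∈ Icc 1 N, v n‖ ≤ 2 * d * L ^ 2 := by
  calc ‖∑ n ∈ Icc 1 N, ∑ i ∈ range L, v (n + i * d) - L * ∑ n ∈ Icc 1 N, v n‖
      = ‖∑ i ∈ range L, (∑ n ∈ Icc 1 N, v (n + i * d) - ∑ n ∈ Icc 1 N, v n)‖ := by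
        rw [sum_sub_distrib, sum_comm, sum_const, card_range, nsmul_eq_mul]
    _ ≤ ∑ _i ∈ range L, (2 * (L * d) : ℝ) := norm_sum_le_of_le _ fun i hi => by
        refine (norm_sum_Icc_shift_sub_le hv N _).trans ?_
        have : (i : ℝ) ≤ L := by exact_mod_cast (mem_range.1 hi).le
        push_cast
        gcongr
    _ = 2 * d * L ^ 2 := by
        rw [sum_const, card_range, nsmul_eq_mul]
        ring

theorem mul_norm_sum_le_of_correlations_le (hv : ∀ n, ‖v n‖ ≤ 1) {η : ℝ} {N L d : ℕ}
    (hη : 0 ≤ η) (hcorr : ∀ i ∈ range L, ∀ j ∈ range L, i ≠ j →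
      ‖∑ n ∈ Icc 1 N, v (n + i * d) * conj (v (n + j * d))‖ ≤ η * N) :
    L * ‖∑ n ∈ Icc 1 N, v n‖ ≤ N * √(L + L ^ 2 * η) + 2 * d * L ^ 2 := by
  have hpair : ∀ i ∈ range L, ∀ j ∈ range L,
      ‖∑ n ∈ Icc 1 N, v (n + i * d) * conj (v (n + j * d))‖ ≤
        (if i = j then (N : ℝ) else 0) + η * N := by
    intro i hi j hj
    have hηN : 0 ≤ η * N := by positivity
    split_ifs with hij
    · refine le_add_of_le_of_nonneg ((norm_sum_le_of_le _ fun n _ =>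
        norm_mul_conj_le_one (hv (n + i * d)) (hv (n + j * d))).trans ?_) hηN
      simp
    · simpa using hcorr i hi j hj hij
  have hsq : ∑ n ∈ Icc 1 N, ‖∑ i ∈ range L, v (n + i * d)‖ ^ 2 ≤
      #(Icc 1 N) * (L + L ^ 2 * η) := by
    calc ∑ n ∈ Icc 1 N, ‖∑ i ∈ range L, v (n + i * d)‖ ^ 2
        ≤ ∑ i ∈ range L, ∑ j ∈ range L,
            ‖∑ n ∈ Icc 1 N, v (n + i * d) * conj (v (n + j * d))‖ := by
          simpa using sum_norm_sum_mul_sq_le (Icc 1 N) (range L) (c := fun _ => 1) (by simp)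
            fun i n => v (n + i * d)
      _ ≤ ∑ i ∈ range L, ∑ j ∈ range L, ((if i = j then (N : ℝ) else 0) + η * N) :=
          sum_le_sum fun i hi => sum_le_sum fun j hj => hpair i hi j hj
      _ = ∑ _i ∈ range L, ((N : ℝ) + L * (η * N)) := sum_congr rfl fun i hi => by
          rw [sum_add_distrib, sum_ite_eq, if_pos hi, sum_const, card_range, nsmul_eq_mul]
      _ = #(Icc 1 N) * (L + L ^ 2 * η) := by
          rw [sum_const, card_range, nsmul_eq_mul, Nat.card_Icc, Nat.add_sub_cancel]
          ring
  have hCS := norm_sum_mul_le_of_sum_sq_le (a := fun _ => 1) (by simp) hsq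
  simp only [one_mul, Nat.card_Icc, Nat.add_sub_cancel] at hCS
  have htriangle := norm_sub_norm_le (L * ∑ n ∈ Icc 1 N, v n)
    (∑ n ∈ Icc 1 N, ∑ i ∈ range L, v (n + i * d))
  rw [norm_sub_rev, norm_mul, Complex.norm_natCast] at htriangle
  linarith [norm_sum_sum_shift_sub_le hv N L d]

variable {c : ℕ → ℂ}

theorem eventually_norm_sum_shift_mul_conj_le (hv : ∀ n, ‖v n‖ ≤ 1)
    (hc : ∀ k, HasMean (fun n => v (n + k) * conj (v n)) (c k)) {η : ℝ} {d : ℕ}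
    (hd : ∀ k ≥ d, ‖c k‖ < η) {i j : ℕ} (hij : i ≠ j) :
    ∀ᶠ N : ℕ in atTop, ‖∑ n ∈ Icc 1 N, v (n + i * d) * conj (v (n + j * d))‖ ≤ η * N := by
  wlog hji : j < i generalizing i j
  · filter_upwards [this hij.symm (hij.lt_or_gt.resolve_right hji)] with N hN
    rw [← RCLike.norm_conj, map_sum]
    simpa only [map_mul, Complex.conj_conj, mul_comm (conj _)] using hN
  have hshift := (hc ((i - j) * d)).shift (fun n => norm_mul_conj_le_one (hv _) (hv n)) (j * d)
  have hindex : ∀ n, n + j * d + (i - j) * d = n + i * d := fun n => by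
    rw [add_assoc, ← add_mul, Nat.add_sub_cancel' hji.le]
  simp only [hindex] at hshift
  have hlt := hd _ (Nat.le_mul_of_pos_left d (Nat.sub_pos_of_lt hji))
  filter_upwards [hshift.norm.eventually_lt_const hlt, eventually_gt_atTop 0] with N hN hN0
  rw [norm_mul, norm_div, norm_one, Complex.norm_natCast, one_div_mul_eq_div,
    div_lt_iff₀ (by exact_mod_cast hN0)] at hN
  exact hN.le

theorem hasMean_zero_of_correlations (hv : ∀ n, ‖v n‖ ≤ 1)
    (hc : ∀ k, HasMean (fun n => v (n + k) * conj (v n)) (c k)) (hc0 : Tendsto c atTop (𝓝 0)) :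
    HasMean v 0 := by
  refine hasMean_zero_iff.2 fun ε hε => ?_
  obtain ⟨d, hd⟩ : ∃ d, ∀ k ≥ d, ‖c k‖ < ε ^ 2 / 8 := eventually_atTop.1 <|
    hc0.norm.eventually_lt_const (by rw [norm_zero]; positivity)
  obtain ⟨L, hL⟩ := exists_nat_gt (8 / ε ^ 2)
  have hL0 : (0 : ℝ) < L := lt_trans (by positivity) hL
  have hsqrt : √(L + L ^ 2 * (ε ^ 2 / 8)) ≤ L * (ε / 2) := by
    rw [div_lt_iff₀ (by positivity)] at hL
    refine Real.sqrt_le_iff.2 ⟨by positivity, ?_⟩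
    nlinarith [mul_lt_mul_of_pos_left hL hL0]
  have hcorr : ∀ᶠ N : ℕ in atTop, ∀ i ∈ range L, ∀ j ∈ range L, i ≠ j →
      ‖∑ n ∈ Icc 1 N, v (n + i * d) * conj (v (n + j * d))‖ ≤ ε ^ 2 / 8 * N := by
    simp only [eventually_all_finset, eventually_imp_distrib_left]
    exact fun i _ j _ hij => eventually_norm_sum_shift_mul_conj_le hv hc hd hij
  filter_upwards [hcorr, eventually_ge_atTop ⌈4 * d * L / ε⌉₊] with N hN hNL
  have hvdC := mul_norm_sum_le_of_correlations_le hv (by positivity) hN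
  have hshift : 4 * d * L ≤ N * ε := (div_le_iff₀ hε).1 (Nat.ceil_le.1 hNL)
  refine le_of_mul_le_mul_left ?_ hL0
  nlinarith [mul_le_mul_of_nonneg_left hsqrt N.cast_nonneg,
    mul_le_mul_of_nonneg_left hshift hL0.le]

end VanDerCorput

theorem norm_geom_sum_le {z : ℂ} (hz : ‖z‖ = 1) (hz1 : z ≠ 1) (N : ℕ) :
    ‖∑ i ∈ range N, z ^ i‖ ≤ 2 / ‖z - 1‖ := by
  rw [geom_sum_eq hz1, norm_div]
  refine div_le_div_of_nonneg_right ((norm_sub_le _ _).trans ?_) (norm_nonneg _)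
  rw [norm_pow, hz, one_pow, norm_one, one_add_one_eq_two]

theorem hasMean_pow {z : ℂ} (hz : ‖z‖ = 1) (hz1 : z ≠ 1) : HasMean (fun n => z ^ n) 0 := by
  refine hasMean_zero_iff.2 fun ε hε => ?_
  filter_upwards [eventually_ge_atTop ⌈2 / ‖z - 1‖ / ε⌉₊] with N hN
  simp_rw [sum_Icc_one_eq_sum_range, pow_succ, ← sum_mul]
  rw [norm_mul, hz, mul_one, mul_comm ε]
  exact (norm_geom_sum_le hz hz1 N).trans ((div_le_iff₀ hε).1 (Nat.ceil_le.1 hN))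

/-- The normalized Haar measure on the torus. -/
noncomputable def torusHaar (d : Type*) [Fintype d] : Measure (UnitAddTorus d) :=
  Measure.pi fun _ => AddCircle.haarAddCircle

section Torus

variable {d : Type*} [Fintype d]

instance : (torusHaar d).IsAddHaarMeasure := by unfold torusHaar; infer_instance

instance : IsProbabilityMeasure (torusHaar d) := by unfold torusHaar; infer_instance

theorem mFourier_apply_add (ξ : d → ℤ) (x y : UnitAddTorus d) :
    mFourier ξ (x + y) = mFourier ξ x * mFourier ξ y := by
  simp only [mFourier, ContinuousMap.coe_mk, Pi.add_apply, ← Finset.prod_mul_distrib]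
  refine Finset.prod_congr rfl fun i _ => ?_
  simp [fourier_apply, smul_add, AddCircle.toCircle_add]

theorem norm_mFourier_apply (ξ : d → ℤ) (x : UnitAddTorus d) : ‖mFourier ξ x‖ = 1 := by
  simp only [mFourier, fourier_apply, ContinuousMap.coe_mk, norm_prod, Circle.norm_coe,
    Finset.prod_const_one]

theorem mFourier_apply_zero (ξ : d → ℤ) : mFourier ξ (0 : UnitAddTorus d) = 1 := by
  simp [mFourier]

theorem mFourier_apply_nsmul (ξ : d → ℤ) (x : UnitAddTorus d) (n : ℕ) :
    mFourier ξ (n • x) = mFourier ξ x ^ n := by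
  induction n with
  | zero => rw [zero_smul, mFourier_apply_zero, pow_zero]
  | succ n ih => rw [succ_nsmul, mFourier_apply_add, ih, pow_succ]

theorem exists_mem_span_mFourier_norm_sub_lt (g : C(UnitAddTorus d, ℂ)) {ε : ℝ} (hε : 0 < ε) :
    ∃ f ∈ Submodule.span ℂ (Set.range (mFourier (d := d))), ‖g - f‖ < ε := by
  have hdense : g ∈ closure (Submodule.span ℂ (Set.range (mFourier (d := d))) : Set _) := by
    rw [← Submodule.topologicalClosure_coe, UnitAddTorus.span_mFourier_closure_eq_top]
    trivial
  obtain ⟨f, hf, hgf⟩ := Metric.mem_closure_iff.1 hdense ε hε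
  exact ⟨f, hf, by rwa [dist_eq_norm] at hgf⟩

theorem integrable_torusHaar {E : Type*} [NormedAddCommGroup E] {g : UnitAddTorus d → E}
    (hg : Continuous g) : Integrable g (torusHaar d) :=
  hg.integrable_of_hasCompactSupport (HasCompactSupport.of_compactSpace _)

theorem integral_mFourier_eq_zero {ξ : d → ℤ} {θ : UnitAddTorus d} (h : mFourier ξ θ ≠ 1) :
    ∫ x, mFourier ξ x ∂(torusHaar d) = 0 := by
  have hinv := integral_add_right_eq_self (μ := torusHaar d) (fun x => mFourier ξ x) θ
  simp_rw [mFourier_apply_add, integral_mul_const] at hinv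
  exact (mul_right_eq_self₀.1 hinv).resolve_left h

variable {θ : UnitAddTorus d}

theorem hasMean_mFourier_orbit (hθ : ∀ ξ : d → ℤ, ξ ≠ 0 → mFourier ξ θ ≠ 1)
    (x : UnitAddTorus d) (ξ : d → ℤ) :
    HasMean (fun n => mFourier ξ (x + n • θ)) (∫ w, mFourier ξ w ∂(torusHaar d)) := by
  rcases eq_or_ne ξ 0 with rfl | hξ
  · simp only [UnitAddTorus.mFourier_zero, ContinuousMap.one_apply, integral_const, probReal_univ,
      one_smul]
    exact HasMean.const 1
  · rw [integral_mFourier_eq_zero (hθ ξ hξ)]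
    simpa only [mFourier_apply_add, mFourier_apply_nsmul, mul_zero] using
      (hasMean_pow (norm_mFourier_apply ξ θ) (hθ ξ hξ)).const_mul (mFourier ξ x)

theorem hasMean_torus_orbit (hθ : ∀ ξ : d → ℤ, ξ ≠ 0 → mFourier ξ θ ≠ 1)
    (g : C(UnitAddTorus d, ℂ)) (x : UnitAddTorus d) :
    HasMean (fun n => g (x + n • θ)) (∫ w, g w ∂(torusHaar d)) := by
  have hspan : ∀ f ∈ Submodule.span ℂ (Set.range (mFourier (d := d))),
      HasMean (fun n => f (x + n • θ)) (∫ w, f w ∂(torusHaar d)) := by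
    intro f hf
    induction hf using Submodule.span_induction with
    | mem f hf =>
      obtain ⟨ξ, rfl⟩ := hf
      exact hasMean_mFourier_orbit hθ x ξ
    | zero => simpa using HasMean.const 0
    | add f₁ f₂ _ _ h₁ h₂ =>
      simp only [ContinuousMap.add_apply]
      rw [integral_add (integrable_torusHaar f₁.continuous)
        (integrable_torusHaar f₂.continuous)]
      exact h₁.add h₂
    | smul a f _ h =>
      simpa only [ContinuousMap.smul_apply, smul_eq_mul, integral_const_mul] using h.const_mul a
  suffices h : HasMean (fun n => g (x + n • θ) - ∫ w, g w ∂(torusHaar d)) 0 by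
    simpa using h.add (HasMean.const (∫ w, g w ∂(torusHaar d)))
  refine HasMean.of_uniform_approx fun ε hε => ?_
  obtain ⟨f, hf, hgf⟩ := exists_mem_span_mFourier_norm_sub_lt g (half_pos hε)
  refine ⟨fun n => f (x + n • θ) + -∫ w, f w ∂(torusHaar d), ?_, fun n => ?_⟩
  · simpa using (hspan f hf).add (HasMean.const (-∫ w, f w ∂(torusHaar d)))
  have hpt : ∀ w, ‖g w - f w‖ ≤ ‖g - f‖ := fun w => (g - f).norm_coe_le_norm w
  have hint : ‖∫ w, g w ∂(torusHaar d) - ∫ w, f w ∂(torusHaar d)‖ ≤ ‖g - f‖ := by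
    rw [← integral_sub (integrable_torusHaar g.continuous)
      (integrable_torusHaar f.continuous)]
    simpa using norm_integral_le_of_norm_le_const (μ := torusHaar d) (Eventually.of_forall hpt)
  beta_reduce
  rw [← sub_eq_add_neg, sub_sub_sub_comm]
  exact (norm_sub_le _ _).trans (by linarith [hpt (x + n • θ)])

end Torus

section Parseval

variable {d : Type*} [Fintype d]

theorem hasSum_sq_mFourierCoeff_continuous (g : C(UnitAddTorus d, ℂ)) :
    HasSum (fun ξ : d → ℤ => ‖mFourierCoeff g ξ‖ ^ 2) (∫ w, ‖g w‖ ^ 2 ∂(torusHaar d)) := by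
  have h := UnitAddTorus.hasSum_sq_mFourierCoeff (g.toLp 2 (torusHaar d) ℂ)
  have hcoeff : ∀ ξ, mFourierCoeff (g.toLp 2 (torusHaar d) ℂ) ξ = mFourierCoeff g ξ :=
    UnitAddTorus.mFourierCoeff_toLp g
  have hnorm : ∫ w, ‖(g.toLp 2 (torusHaar d) ℂ) w‖ ^ 2 ∂(torusHaar d) =
      ∫ w, ‖g w‖ ^ 2 ∂(torusHaar d) := by
    refine integral_congr_ae ?_
    filter_upwards [ContinuousMap.coeFn_toLp (p := 2) (torusHaar d) (𝕜 := ℂ) g] with w hw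
    rw [hw]
  rw [← hnorm]
  exact h.congr_fun fun ξ => congrArg (‖·‖ ^ 2) (hcoeff ξ).symm

theorem mFourierCoeff_eq_integral (g : UnitAddTorus d → ℂ) (ξ : d → ℤ) :
    mFourierCoeff g ξ = ∫ w, mFourier (-ξ) w * g w ∂(torusHaar d) := rfl

theorem mFourierCoeff_translate (g : UnitAddTorus d → ℂ) (a : UnitAddTorus d) (ξ : d → ℤ) :
    mFourierCoeff (fun w => g (w + a)) ξ = mFourier ξ a * mFourierCoeff g ξ := by
  have hunit : mFourier ξ a * conj (mFourier ξ a) = 1 := by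
    rw [Complex.mul_conj', norm_mFourier_apply, Complex.ofReal_one, one_pow]
  rw [mFourierCoeff_eq_integral, mFourierCoeff_eq_integral,
    ← integral_add_right_eq_self (fun w => mFourier (-ξ) w * g w) a, ← integral_const_mul]
  refine integral_congr_ae (Eventually.of_forall fun w => ?_)
  simp only [mFourier_apply_add, UnitAddTorus.mFourier_neg (x := a)]
  linear_combination (-mFourier (-ξ) w * g (w + a)) * hunit

theorem mFourierCoeff_sum_translate_sub {ι : Type*} (s : Finset ι) (a b : ι → UnitAddTorus d)
    (g : C(UnitAddTorus d, ℂ)) (ξ : d → ℤ) :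
    mFourierCoeff (fun w => ∑ i ∈ s, (g (w + a i) - g (w + b i))) ξ =
      (∑ i ∈ s, (mFourier ξ (a i) - mFourier ξ (b i))) * mFourierCoeff g ξ := by
  have hint : ∀ c : UnitAddTorus d,
      Integrable (fun w => mFourier (-ξ) w * g (w + c)) (torusHaar d) := fun c =>
    integrable_torusHaar (by fun_prop)
  rw [mFourierCoeff_eq_integral]
  simp_rw [mul_sum, mul_sub]
  rw [integral_finsetSum _ fun i _ => by exact (hint (a i)).sub (hint (b i)), sum_mul]
  refine sum_congr rfl fun i _ => ?_
  rw [integral_sub (hint _) (hint _), ← mFourierCoeff_eq_integral fun w => g (w + a i),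
    ← mFourierCoeff_eq_integral fun w => g (w + b i), mFourierCoeff_translate,
    mFourierCoeff_translate, sub_mul]

theorem hasSum_sq_translate_combination {ι : Type*} (s : Finset ι) (a b : ι → UnitAddTorus d)
    (g : C(UnitAddTorus d, ℂ)) :
    HasSum (fun ξ : d → ℤ => ‖(∑ i ∈ s, (mFourier ξ (a i) - mFourier ξ (b i))) *
      mFourierCoeff g ξ‖ ^ 2)
      (∫ w, ‖∑ i ∈ s, (g (w + a i) - g (w + b i))‖ ^ 2 ∂(torusHaar d)) := by
  simp_rw [← mFourierCoeff_sum_translate_sub]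
  exact hasSum_sq_mFourierCoeff_continuous ⟨fun w => ∑ i ∈ s, (g (w + a i) - g (w + b i)),
    by fun_prop⟩

end Parseval

section FourierChar

theorem coe_fourierChar_add (s t : ℝ) : (𝐞 (s + t) : ℂ) = 𝐞 s * 𝐞 t := by
  rw [AddChar.map_add_eq_mul, Circle.coe_mul]

theorem conj_fourierChar (t : ℝ) : conj (𝐞 t : ℂ) = 𝐞 (-t) := by
  rw [AddChar.map_neg_eq_inv, Circle.coe_inv_eq_conj]

theorem coe_fourierChar_half : (𝐞 (1 / 2) : ℂ) = -1 := by
  rw [Real.fourierChar_apply, ← Complex.exp_pi_mul_I]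
  congr 2
  ring_nf

theorem norm_fourierChar_sub_one_le (t : ℝ) : ‖(𝐞 t : ℂ) - 1‖ ≤ 2 * Real.pi * |t| := by
  rw [Real.fourierChar_apply, mul_comm (_ : ℂ)]
  refine Real.norm_exp_I_mul_ofReal_sub_one_le.trans_eq ?_
  rw [Real.norm_eq_abs, abs_mul, abs_of_pos Real.two_pi_pos]

theorem tendsto_norm_fourierChar_sub_one_div (a : ℝ) :
    Tendsto (fun r : ℝ => ‖(𝐞 (a * r) : ℂ) - 1‖ / r) (𝓝[>] 0) (𝓝 (2 * Real.pi * |a|)) := by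
  have hderiv : HasDerivAt (fun r : ℝ => (𝐞 (a * r) : ℂ)) (2 * Real.pi * Complex.I * a) 0 := by
    have hchar := Real.hasDerivAt_fourierChar (a * 0)
    have hcomp := hchar.scomp (0 : ℝ) ((hasDerivAt_id (0 : ℝ)).const_mul a)
    simpa [Function.comp_def, mul_comm] using hcomp
  have hslope := (hasDerivAt_iff_tendsto_slope_zero.1 hderiv).norm.mono_left
    (nhdsWithin_mono (0 : ℝ) fun r (hr : 0 < r) => hr.ne')
  have hnorm : ‖2 * Real.pi * Complex.I * a‖ = 2 * Real.pi * |a| := by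
    simp [abs_of_pos Real.pi_pos]
  rw [hnorm] at hslope
  refine hslope.congr' ?_
  filter_upwards [self_mem_nhdsWithin] with r (hr : 0 < r)
  rw [zero_add, mul_zero, AddChar.map_zero_eq_one, Circle.coe_one, norm_smul, norm_inv,
    Real.norm_of_nonneg hr.le, inv_mul_eq_div]

end FourierChar

/-- The image in the two-dimensional torus of a point of the plane. -/
def toTorus₂ (x y : ℝ) : UnitAddTorus (Fin 2) := ![(x : UnitAddCircle), (y : UnitAddCircle)]

section PlaneToTorus

theorem toTorus₂_add (x y x' y' : ℝ) :
    toTorus₂ (x + x') (y + y') = toTorus₂ x y + toTorus₂ x' y' := by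
  ext i; fin_cases i <;> simp [toTorus₂]

theorem toTorus₂_nsmul (n : ℕ) (x y : ℝ) : toTorus₂ (n * x) (n * y) = n • toTorus₂ x y := by
  ext i; fin_cases i <;> simp [toTorus₂, ← nsmul_eq_mul]

theorem toTorus₂_surjective (w : UnitAddTorus (Fin 2)) : ∃ x y : ℝ, toTorus₂ x y = w := by
  obtain ⟨x, hx⟩ := QuotientAddGroup.mk_surjective (w 0)
  obtain ⟨y, hy⟩ := QuotientAddGroup.mk_surjective (w 1)
  refine ⟨x, y, funext fun i => ?_⟩
  fin_cases i
  exacts [hx, hy]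

theorem mFourier_toTorus₂ (ξ : Fin 2 → ℤ) (x y : ℝ) :
    mFourier ξ (toTorus₂ x y) = 𝐞 (ξ 0 * x + ξ 1 * y) := by
  simp only [mFourier, ContinuousMap.coe_mk, Fin.prod_univ_two, toTorus₂, Matrix.cons_val_zero,
    Matrix.cons_val_one]
  rw [fourier_coe_apply, fourier_coe_apply, ← Complex.exp_add, Real.fourierChar_apply]
  push_cast
  ring_nf

theorem mFourier_toTorus₂_zero_left (ξ : Fin 2 → ℤ) (r : ℝ) :
    mFourier ξ (toTorus₂ 0 r) = 𝐞 (ξ 1 * r) := by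
  rw [mFourier_toTorus₂, mul_zero, zero_add]

end PlaneToTorus

section VerticalIncrements

variable {g : C(UnitAddTorus (Fin 2), ℂ)} {K : ℝ}

theorem sum_sq_mul_mFourierCoeff_le {r : ℝ} (hg : ∀ w, ‖g (w + toTorus₂ 0 r) - g w‖ ≤ K * r)
    (S : Finset (Fin 2 → ℤ)) :
    ∑ ξ ∈ S, ‖(𝐞 (ξ 1 * r) : ℂ) - 1‖ ^ 2 * ‖mFourierCoeff g ξ‖ ^ 2 ≤ (K * r) ^ 2 := by
  have hparseval := hasSum_sq_translate_combination {()} (fun _ => toTorus₂ 0 r) (fun _ => 0) g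
  simp only [sum_singleton, add_zero, mFourier_apply_zero, mFourier_toTorus₂_zero_left, norm_mul,
    mul_pow] at hparseval
  have hle : ∫ w, ‖g (w + toTorus₂ 0 r) - g w‖ ^ 2 ∂(torusHaar (Fin 2)) ≤ (K * r) ^ 2 := by
    refine (Real.le_norm_self _).trans ((norm_integral_le_of_norm_le_const (C := (K * r) ^ 2)
      (Eventually.of_forall fun w => ?_)).trans_eq (by rw [probReal_univ, mul_one]))
    rw [Real.norm_of_nonneg (by positivity)]
    exact pow_le_pow_left₀ (norm_nonneg _) (hg w) 2
  exact (sum_le_hasSum S (fun ξ _ => by positivity) hparseval).trans hle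

theorem summable_vertical_sq_mFourierCoeff
    (hg : ∀ᶠ r in 𝓝[>] 0, ∀ w, ‖g (w + toTorus₂ 0 r) - g w‖ ≤ K * r) :
    Summable fun ξ : Fin 2 → ℤ => (2 * Real.pi * |(ξ 1 : ℝ)|) ^ 2 * ‖mFourierCoeff g ξ‖ ^ 2 := by
  refine summable_of_sum_le (c := K ^ 2) (fun ξ => by positivity) fun S => ?_
  have hlim : Tendsto (fun r : ℝ => ∑ ξ ∈ S, (‖(𝐞 (ξ 1 * r) : ℂ) - 1‖ / r) ^ 2 *
      ‖mFourierCoeff g ξ‖ ^ 2) (𝓝[>] 0)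
      (𝓝 (∑ ξ ∈ S, (2 * Real.pi * |(ξ 1 : ℝ)|) ^ 2 * ‖mFourierCoeff g ξ‖ ^ 2)) :=
    tendsto_finsetSum _ fun ξ _ =>
      ((tendsto_norm_fourierChar_sub_one_div (ξ 1)).pow 2).mul_const _
  refine le_of_tendsto hlim ?_
  filter_upwards [hg, self_mem_nhdsWithin] with r hr (hr0 : 0 < r)
  have hsum := sum_sq_mul_mFourierCoeff_le hr S
  simp_rw [div_pow, div_mul_eq_mul_div]
  rwa [← sum_div, div_le_iff₀ (pow_pos hr0 2), ← mul_pow]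

theorem integral_sq_sum_increments_eq_tsum (θ a : UnitAddTorus (Fin 2)) (N : ℕ) :
    ∫ w, ‖∑ i ∈ range N, (g (w + (i • θ + a)) - g (w + i • θ))‖ ^ 2 ∂(torusHaar (Fin 2)) =
      ∑' ξ : Fin 2 → ℤ, (‖mFourier ξ a - 1‖ * ‖∑ i ∈ range N, mFourier ξ θ ^ i‖) ^ 2 *
        ‖mFourierCoeff g ξ‖ ^ 2 := by
  rw [← (hasSum_sq_translate_combination (range N) (fun i => i • θ + a) (fun i => i • θ) g).tsum_eq]
  refine tsum_congr fun ξ => ?_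
  rw [norm_mul, mul_pow, ← norm_mul, mul_sum]
  simp only [mFourier_apply_add, mFourier_apply_nsmul, sub_one_mul, mul_comm (mFourier ξ a)]

theorem tendsto_increment_multiplier {θ : UnitAddTorus (Fin 2)}
    (hθ : ∀ ξ : Fin 2 → ℤ, ξ ≠ 0 → mFourier ξ θ ≠ 1) (ξ : Fin 2 → ℤ) (p : ℕ) (s : ℝ) :
    Tendsto (fun k : ℕ => ‖mFourier ξ (toTorus₂ 0 (s / k)) - 1‖ *
      ‖∑ i ∈ range (p * k), mFourier ξ θ ^ i‖) atTop (𝓝 0) := by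
  simp_rw [mFourier_toTorus₂_zero_left]
  by_cases hξ : ξ 1 = 0
  · simp [hξ]
  have hgeom := norm_geom_sum_le (norm_mFourier_apply ξ θ) (hθ ξ fun h => hξ (congrFun h 1))
  have hlim := ((((tendsto_const_div_atTop_nhds_zero_nat s).const_mul (ξ 1 : ℝ)).abs.const_mul
    (2 * Real.pi)).mul_const (2 / ‖mFourier ξ θ - 1‖))
  rw [mul_zero, abs_zero, mul_zero, zero_mul] at hlim
  exact squeeze_zero (fun k => by positivity) (fun k => mul_le_mul (norm_fourierChar_sub_one_le _)
    (hgeom _) (norm_nonneg _) (by positivity)) hlim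

theorem increment_multiplier_le (θ : UnitAddTorus (Fin 2)) (ξ : Fin 2 → ℤ) (p k : ℕ) (s : ℝ) :
    ‖mFourier ξ (toTorus₂ 0 (s / k)) - 1‖ * ‖∑ i ∈ range (p * k), mFourier ξ θ ^ i‖ ≤
      |s| * p * (2 * Real.pi * |(ξ 1 : ℝ)|) := by
  have hsum : ‖∑ i ∈ range (p * k), mFourier ξ θ ^ i‖ ≤ p * k := by
    refine (norm_sum_le_of_le (n := fun _ => 1) _ fun i _ => ?_).trans (by simp)
    rw [norm_pow, norm_mFourier_apply, one_pow]
  have hdiv : |s / k| * k ≤ |s| := by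
    rw [abs_div, Nat.abs_cast, div_mul_eq_mul_div, mul_div_assoc]
    exact mul_le_of_le_one_right (abs_nonneg s) (div_self_le_one _)
  rw [mFourier_toTorus₂_zero_left]
  calc _ ≤ (2 * Real.pi * |ξ 1 * (s / k)|) * (p * k) :=
        mul_le_mul (norm_fourierChar_sub_one_le _) hsum (norm_nonneg _) (by positivity)
    _ = (|s / k| * k) * p * (2 * Real.pi * |(ξ 1 : ℝ)|) := by rw [abs_mul]; ring
    _ ≤ |s| * p * (2 * Real.pi * |(ξ 1 : ℝ)|) := by gcongr

/-- The steps are as small as the number of summands is large: a termwise bound is only `O(1)`,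
and the decay comes from the cancellation in each Fourier mode, dominated via the `L²` derivative
of `g`. -/
theorem tendsto_integral_sq_sum_increments {θ : UnitAddTorus (Fin 2)}
    (hθ : ∀ ξ : Fin 2 → ℤ, ξ ≠ 0 → mFourier ξ θ ≠ 1)
    (hg : ∀ᶠ r in 𝓝[>] 0, ∀ w, ‖g (w + toTorus₂ 0 r) - g w‖ ≤ K * r) (p : ℕ) (s : ℝ) :
    Tendsto (fun k : ℕ => ∫ w, ‖∑ i ∈ range (p * k), (g (w + (i • θ + toTorus₂ 0 (s / k))) -
      g (w + i • θ))‖ ^ 2 ∂(torusHaar (Fin 2))) atTop (𝓝 0) := by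
  simp_rw [integral_sq_sum_increments_eq_tsum]
  suffices h : Tendsto _ atTop (𝓝 (∑' _ : Fin 2 → ℤ, (0 : ℝ))) by rwa [tsum_zero] at h
  refine tendsto_tsum_of_dominated_convergence
    ((summable_vertical_sq_mFourierCoeff hg).mul_left ((|s| * p) ^ 2)) (fun ξ => ?_)
    (Eventually.of_forall fun k ξ => ?_)
  · simpa using ((tendsto_increment_multiplier hθ ξ p s).pow 2).mul_const _
  · rw [Real.norm_of_nonneg (by positivity), ← mul_assoc, ← mul_pow (|s| * p)]
    exact mul_le_mul_of_nonneg_right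
      (pow_le_pow_left₀ (by positivity) (increment_multiplier_le θ ξ p k s) 2) (sq_nonneg _)

/-- The vertical increment, over a step `r`, of the Birkhoff sum of length `j` of `h₀` along the
rotation by `θ`. -/
def birkhoffIncrement (h₀ : C(UnitAddTorus (Fin 2), ℝ)) (θ : UnitAddTorus (Fin 2)) (j : ℕ) (r : ℝ)
    (w : UnitAddTorus (Fin 2)) : ℝ :=
  ∑ i ∈ range j, (h₀ (w + (i • θ + toTorus₂ 0 r)) - h₀ (w + i • θ))

theorem birkhoffIncrement_succ (h₀ : C(UnitAddTorus (Fin 2), ℝ)) (θ : UnitAddTorus (Fin 2)) (j : ℕ)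
    (r : ℝ) (w : UnitAddTorus (Fin 2)) : birkhoffIncrement h₀ θ (j + 1) r w =
      birkhoffIncrement h₀ θ j r w + (h₀ (w + (j • θ + toTorus₂ 0 r)) - h₀ (w + j • θ)) :=
  sum_range_succ _ _

theorem continuous_birkhoffIncrement (h₀ : C(UnitAddTorus (Fin 2), ℝ)) (θ : UnitAddTorus (Fin 2))
    (j : ℕ) (r : ℝ) : Continuous (birkhoffIncrement h₀ θ j r) := by
  unfold birkhoffIncrement
  fun_prop

theorem tendsto_integral_sq_birkhoffIncrement {θ : UnitAddTorus (Fin 2)}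
    {h₀ : C(UnitAddTorus (Fin 2), ℝ)} (hθ : ∀ ξ : Fin 2 → ℤ, ξ ≠ 0 → mFourier ξ θ ≠ 1)
    (hh₀ : ∀ᶠ r in 𝓝[>] 0, ∀ w, |h₀ (w + toTorus₂ 0 r) - h₀ w| ≤ K * r) (p : ℕ) (s : ℝ) :
    Tendsto (fun k : ℕ => ∫ w, birkhoffIncrement h₀ θ (p * k) (s / k) w ^ 2 ∂(torusHaar (Fin 2)))
      atTop (𝓝 0) := by
  have h := tendsto_integral_sq_sum_increments (g := ⟨fun w => (h₀ w : ℂ), by fun_prop⟩)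
    (K := K) hθ (by simpa [← Complex.ofReal_sub] using hh₀) p s
  simpa [← Complex.ofReal_sub, ← Complex.ofReal_sum, birkhoffIncrement] using h

end VerticalIncrements

theorem mFourier_toTorus₂_ne_one {α β : ℝ} (hαβ : LinearIndependent ℚ ![α, β, 1])
    {ξ : Fin 2 → ℤ} (hξ : ξ ≠ 0) : mFourier ξ (toTorus₂ α β) ≠ 1 := by
  intro h
  rw [mFourier_toTorus₂, Real.fourierChar_apply] at h
  obtain ⟨n, hn⟩ := Complex.exp_eq_one_iff.1 h
  have hrel : (ξ 0 * α + ξ 1 * β : ℝ) = n := by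
    have hcancel : ((ξ 0 * α + ξ 1 * β : ℝ) : ℂ) = n :=
      mul_left_cancel₀ Complex.two_pi_I_ne_zero (by rw [← mul_comm (n : ℂ), ← hn]; push_cast; ring)
    exact_mod_cast hcancel
  have hcoord := Fintype.linearIndependent_iff.1 hαβ ![(ξ 0 : ℚ), (ξ 1 : ℚ), -(n : ℚ)] (by
    simp [Fin.sum_univ_three, Rat.smul_def, hrel])
  refine hξ (funext fun i => ?_)
  fin_cases i
  · simpa using hcoord 0
  · simpa using hcoord 1

section TorusLift

theorem continuous_toTorus₂ : Continuous fun p : ℝ × ℝ => toTorus₂ p.1 p.2 := by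
  refine continuous_pi fun i => ?_
  fin_cases i
  · exact (AddCircle.continuous_mk' 1).comp continuous_fst
  · exact (AddCircle.continuous_mk' 1).comp continuous_snd

theorem isQuotientMap_toTorus₂ : IsQuotientMap fun p : ℝ × ℝ => toTorus₂ p.1 p.2 := by
  have hopen : IsOpenMap fun p : ℝ × ℝ => toTorus₂ p.1 p.2 :=
    (Homeomorph.finTwoArrow (X := UnitAddCircle)).symm.isOpenMap.comp
      (QuotientAddGroup.isOpenMap_coe.prodMap QuotientAddGroup.isOpenMap_coe)
  refine hopen.isQuotientMap continuous_toTorus₂ fun w => ?_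
  obtain ⟨x, y, hxy⟩ := toTorus₂_surjective w
  exact ⟨(x, y), hxy⟩

theorem exists_int_add_of_coe_eq {x x' : ℝ} (h : (x : UnitAddCircle) = x') :
    ∃ a : ℤ, x' = x + a := by
  obtain ⟨a, ha⟩ := (AddCircle.coe_eq_zero_iff (1 : ℝ) (x := x' - x)).1 (by simp [h])
  rw [zsmul_one] at ha
  exact ⟨a, by linarith⟩

theorem exists_torus_descent {E : Type*} [TopologicalSpace E] {Φ : ℝ → ℝ → E}
    (hΦ : Continuous fun p : ℝ × ℝ => Φ p.1 p.2) (h₁ : ∀ y, Function.Periodic (Φ · y) 1)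
    (h₂ : ∀ x, Function.Periodic (Φ x) 1) :
    ∃ φ : C(UnitAddTorus (Fin 2), E), ∀ x y, φ (toTorus₂ x y) = Φ x y := by
  let q : C(ℝ × ℝ, UnitAddTorus (Fin 2)) := ⟨_, continuous_toTorus₂⟩
  have hq : IsQuotientMap q := isQuotientMap_toTorus₂
  have hfac : Function.FactorsThrough (⟨_, hΦ⟩ : C(ℝ × ℝ, E)) q := by
    rintro ⟨x, y⟩ ⟨x', y'⟩ h
    obtain ⟨a, rfl⟩ := exists_int_add_of_coe_eq (congrFun h 0 : (x : UnitAddCircle) = x')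
    obtain ⟨b, rfl⟩ := exists_int_add_of_coe_eq (congrFun h 1 : (y : UnitAddCircle) = y')
    have hx := (h₁ (y + b)).int_mul a x
    have hy := (h₂ x).int_mul b y
    rw [mul_one] at hx hy
    exact (hx.trans hy).symm
  exact ⟨hq.lift _ hfac, fun x y => DFunLike.congr_fun (hq.lift_comp _ hfac) (x, y)⟩

theorem exists_eq_intCast_of_continuous {X : Type*} [TopologicalSpace X] [PreconnectedSpace X]
    [Nonempty X] {f : X → ℝ} (hf : Continuous f) (h_int : ∀ x, ∃ n : ℤ, f x = n) :
    ∃ n : ℤ, ∀ x, f x = n := by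
  choose n hn using h_int
  have hcast : IsClosedEmbedding ((↑) : ℤ → ℝ) := Int.isClosedEmbedding_coe_real
  have hcont : Continuous n := hcast.continuous_iff.2 (hf.congr hn)
  obtain ⟨x₀⟩ := ‹Nonempty X›
  exact ⟨n x₀, fun x => by rw [hn, PreconnectedSpace.constant inferInstance hcont]⟩

/-- A lift of `h : 𝕋² → 𝕋` to the plane, written as the sum of the integral linear form
`(x, y) ↦ A * x + B * y`, given by the degrees of `h`, and of a function `h₀` on the torus. -/
def IsTorusLift (h : UnitAddCircle × UnitAddCircle → UnitAddCircle) (A B : ℤ)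
    (h₀ : C(UnitAddTorus (Fin 2), ℝ)) : Prop :=
  ∀ x y : ℝ, ((h₀ (toTorus₂ x y) + A * x + B * y : ℝ) : UnitAddCircle) = h (x, y)

theorem exists_continuous_plane_lift {h : UnitAddCircle × UnitAddCircle → UnitAddCircle}
    (hh : Continuous h) :
    ∃ H : C(ℝ × ℝ, ℝ), ∀ x y : ℝ, (H (x, y) : UnitAddCircle) = h (x, y) := by
  let f : C(ℝ × ℝ, UnitAddCircle) := ⟨fun p => h ((p.1 : UnitAddCircle), (p.2 : UnitAddCircle)),
    hh.comp (((AddCircle.continuous_mk' 1).comp continuous_fst).prodMk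
      ((AddCircle.continuous_mk' 1).comp continuous_snd))⟩
  obtain ⟨e₀, he₀⟩ := QuotientAddGroup.mk_surjective (f 0)
  obtain ⟨H, ⟨-, hH⟩, -⟩ :=
    (AddCircle.isCoveringMap_coe (1 : ℝ)).existsUnique_continuousMap_lifts f 0 e₀ he₀
  exact ⟨H, fun x y => congrFun hH (x, y)⟩

theorem exists_isTorusLift {h : UnitAddCircle × UnitAddCircle → UnitAddCircle}
    (hh : Continuous h) : ∃ A B h₀, IsTorusLift h A B h₀ := by
  obtain ⟨H, hH⟩ := exists_continuous_plane_lift hh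
  have hdeg : ∀ v : ℝ × ℝ, (∀ p : ℝ × ℝ, (H (p + v) : UnitAddCircle) = H p) →
      ∃ n : ℤ, ∀ p, H (p + v) - H p = n := by
    refine fun v hv => exists_eq_intCast_of_continuous (by fun_prop) fun p => ?_
    obtain ⟨a, ha⟩ := exists_int_add_of_coe_eq (hv p).symm
    exact ⟨a, sub_eq_of_eq_add' ha⟩
  obtain ⟨A, hA⟩ := hdeg (1, 0) fun ⟨x, y⟩ => by simp [hH]
  obtain ⟨B, hB⟩ := hdeg (0, 1) fun ⟨x, y⟩ => by simp [hH]
  simp only [Prod.forall, Prod.mk_add_mk, add_zero] at hA hB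
  obtain ⟨h₀, hh₀⟩ := exists_torus_descent (Φ := fun x y => H (x, y) - A * x - B * y)
    (by fun_prop) (fun y x => by linear_combination hA x y)
    (fun x y => by linear_combination hB x y)
  refine ⟨A, B, h₀, fun x y => ?_⟩
  rw [hh₀, ← hH]
  ring_nf

theorem norm_coe_unitAddCircle_le (r : ℝ) : ‖(r : UnitAddCircle)‖ ≤ |r| := by
  rcases le_total |r| (|(1 : ℝ)| / 2) with h | h
  · exact ((AddCircle.norm_coe_eq_abs_iff (1 : ℝ) one_ne_zero).2 h).le
  · exact (AddCircle.norm_le_half_period (1 : ℝ) one_ne_zero).trans h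

theorem abs_le_of_coe_unitAddCircle {t : ℝ} {C : ℝ} (ht : |t| ≤ 1 / 2)
    (h : ‖(t : UnitAddCircle)‖ ≤ C) : |t| ≤ C :=
  ((AddCircle.norm_coe_eq_abs_iff (1 : ℝ) one_ne_zero).2 (by rwa [abs_one])).symm.trans_le h

theorem continuous_toTorus₂_zero_left : Continuous (toTorus₂ 0) :=
  continuous_toTorus₂.comp (f := fun r : ℝ => ((0 : ℝ), r)) (by fun_prop)

theorem toTorus₂_zero : toTorus₂ 0 0 = 0 := by
  ext i; fin_cases i <;> simp [toTorus₂]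

theorem eventually_forall_norm_sub_lt {Y X E : Type*} [TopologicalSpace Y] [TopologicalSpace X]
    [CompactSpace X] [SeminormedAddCommGroup E] {Ψ : Y → X → E} (hΨ : Continuous ↿Ψ) (y₀ : Y)
    {ε : ℝ} (hε : 0 < ε) : ∀ᶠ y in 𝓝 y₀, ∀ x, ‖Ψ y x - Ψ y₀ x‖ < ε := by
  let Ψ' : C(Y × X, E) := ⟨↿Ψ, hΨ⟩
  filter_upwards [Metric.tendsto_nhds.1 (Ψ'.curry.continuous.tendsto y₀) ε hε] with y hy x
  rw [← dist_eq_norm]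
  exact (ContinuousMap.dist_apply_le_dist x).trans_lt hy

theorem eventually_abs_translate_sub_lt (h₀ : C(UnitAddTorus (Fin 2), ℝ)) {ε : ℝ} (hε : 0 < ε) :
    ∀ᶠ r in 𝓝 0, ∀ w, |h₀ (w + toTorus₂ 0 r) - h₀ w| < ε := by
  have hcont : Continuous fun q : ℝ × UnitAddTorus (Fin 2) => h₀ (q.2 + toTorus₂ 0 q.1) := by
    have := continuous_toTorus₂_zero_left
    fun_prop
  simpa only [toTorus₂_zero, add_zero, Real.norm_eq_abs] using
    eventually_forall_norm_sub_lt (Ψ := fun r w => h₀ (w + toTorus₂ 0 r)) hcont 0 hε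

/-- For small `r` the increment of the lift is too short to wrap around the circle, so that its
absolute value is the norm of its class. -/
theorem IsTorusLift.eventually_abs_sub_le {h : UnitAddCircle × UnitAddCircle → UnitAddCircle}
    {A B : ℤ} {h₀ : C(UnitAddTorus (Fin 2), ℝ)} (hh₀ : IsTorusLift h A B h₀) {K : NNReal}
    (hLip : ∀ s, LipschitzWith K fun t => h (s, t)) :
    ∀ᶠ r in 𝓝[>] 0, ∀ w, |h₀ (w + toTorus₂ 0 r) - h₀ w| ≤ (K + |(B : ℝ)|) * r := by
  have hBr : ∀ᶠ r : ℝ in 𝓝 0, |B * r| < 1 / 4 := by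
    refine Continuous.tendsto' (by fun_prop) 0 0 (by simp) |>.eventually_lt_const (by norm_num)
  have hincr := eventually_abs_translate_sub_lt h₀ (show (0 : ℝ) < 1 / 4 by norm_num)
  filter_upwards [hincr.filter_mono nhdsWithin_le_nhds, hBr.filter_mono nhdsWithin_le_nhds,
    self_mem_nhdsWithin] with r hr hBr (hr0 : 0 < r) w
  obtain ⟨x, y, rfl⟩ := toTorus₂_surjective w
  specialize hr (toTorus₂ x y)
  rw [← toTorus₂_add, add_zero] at hr ⊢
  set D := h₀ (toTorus₂ x (y + r)) - h₀ (toTorus₂ x y) with hD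
  have hclass : ((D + B * r : ℝ) : UnitAddCircle) = h (x, (y + r : ℝ)) - h (x, y) := by
    rw [← hh₀, ← hh₀, ← AddCircle.coe_sub, hD]
    ring_nf
  have hnorm : ‖((D + B * r : ℝ) : UnitAddCircle)‖ ≤ K * r := by
    rw [hclass, ← dist_eq_norm]
    refine ((hLip x).dist_le_mul _ _).trans (mul_le_mul_of_nonneg_left ?_ K.2)
    rw [dist_eq_norm, AddCircle.coe_add, add_sub_cancel_left]
    exact (norm_coe_unitAddCircle_le r).trans_eq (abs_of_pos hr0)
  have hsmall : |D + B * r| ≤ 1 / 2 := (abs_add_le _ _).trans (by linarith)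
  calc |D| = |D + B * r - B * r| := by rw [add_sub_cancel_right]
    _ ≤ |D + B * r| + |B * r| := abs_sub _ _
    _ ≤ K * r + |(B : ℝ)| * r :=
        add_le_add (abs_le_of_coe_unitAddCircle hsmall hnorm) (by rw [abs_mul, abs_of_pos hr0])
    _ = (K + |(B : ℝ)|) * r := by ring

end TorusLift

namespace Heis

theorem continuous_mk {Y : Type*} [TopologicalSpace Y] {a b c : Y → ℝ} (ha : Continuous a)
    (hb : Continuous b) (hc : Continuous c) : Continuous fun y => (⟨a y, b y, c y⟩ : Heis) :=
  continuous_induced_rng.2 (ha.prodMk (hb.prodMk hc))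

theorem continuous_equivProd : Continuous equivProd := continuous_induced_dom

@[fun_prop]
theorem continuous_x : Continuous x := continuous_fst.comp continuous_equivProd

@[fun_prop]
theorem continuous_y : Continuous y :=
  (continuous_fst.comp continuous_snd).comp continuous_equivProd

@[fun_prop]
theorem continuous_z : Continuous z :=
  (continuous_snd.comp continuous_snd).comp continuous_equivProd

instance : ContinuousMul Heis :=
  ⟨continuous_mk (by fun_prop) (by fun_prop) (by fun_prop)⟩

/-- The one-parameter subgroup of the centre. -/
def expZ (s : ℝ) : Heis := ⟨0, 0, s⟩

/-- The one-parameter subgroup in the direction of the second coordinate. -/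
def expY (r : ℝ) : Heis := ⟨0, r, 0⟩

theorem continuous_expZ : Continuous expZ := continuous_mk (by fun_prop) (by fun_prop) (by fun_prop)

theorem continuous_expY : Continuous expY := continuous_mk (by fun_prop) (by fun_prop) (by fun_prop)

theorem expZ_zero : expZ 0 = 1 := rfl

theorem expY_zero : expY 0 = 1 := rfl

theorem expZ_add (s t : ℝ) : expZ (s + t) = expZ s * expZ t := by
  ext <;> simp [expZ, mul_def]

theorem expZ_mul_comm (s : ℝ) (g : Heis) : expZ s * g = g * expZ s := by
  ext <;> simp [expZ, mul_def, add_comm]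

theorem exists_mul_lattice_mem_unitCube (g : Heis) :
    ∃ γ ∈ lattice,
      equivProd (g * γ) ∈ Set.Icc (0 : ℝ) 1 ×ˢ Set.Icc (0 : ℝ) 1 ×ˢ Set.Icc (0 : ℝ) 1 := by
  have hfract : ∀ t : ℝ, t + ((-⌊t⌋ : ℤ) : ℝ) ∈ Set.Icc (0 : ℝ) 1 := fun t => by
    rw [Int.cast_neg, ← sub_eq_add_neg, Int.self_sub_floor]
    exact ⟨Int.fract_nonneg t, (Int.fract_lt_one t).le⟩
  let z' := g.z + (g.x * (-⌊g.y⌋ : ℤ) - (-⌊g.x⌋ : ℤ) * g.y)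
  refine ⟨_, ⟨-⌊g.x⌋, -⌊g.y⌋, -⌊z'⌋, rfl⟩, hfract g.x, hfract g.y, ?_⟩
  convert hfract z' using 1
  simp only [equivProd, Equiv.coe_fn_mk, mul_def, z']
  ring

end Heis

namespace HeisNil

open Heis (expZ expY)

theorem mk_mul (g g' : Heis) : (QuotientGroup.mk (g * g') : HeisNil) = g • QuotientGroup.mk g' :=
  rfl

instance : CompactSpace HeisNil := by
  have hcube : IsCompact (Set.Icc (0 : ℝ) 1 ×ˢ Set.Icc (0 : ℝ) 1 ×ˢ Set.Icc (0 : ℝ) 1) :=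
    isCompact_Icc.prod (isCompact_Icc.prod isCompact_Icc)
  have hmk : Continuous fun c : ℝ × ℝ × ℝ => (QuotientGroup.mk (Heis.equivProd.symm c) : HeisNil) :=
    QuotientGroup.continuous_mk.comp
      (Heis.continuous_mk continuous_fst (by fun_prop) (by fun_prop))
  refine ⟨(hcube.image hmk).of_isClosed_subset isClosed_univ fun p _ => ?_⟩
  obtain ⟨g, rfl⟩ := QuotientGroup.mk_surjective p
  obtain ⟨γ, hγ, hmem⟩ := g.exists_mul_lattice_mem_unitCube
  exact ⟨_, hmem, by simpa using QuotientGroup.mk_mul_of_mem g hγ⟩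

theorem expZ_intCast_smul (n : ℤ) (p : HeisNil) : expZ n • p = p := by
  obtain ⟨g, rfl⟩ := QuotientGroup.mk_surjective p
  rw [← mk_mul, Heis.expZ_mul_comm]
  exact QuotientGroup.mk_mul_of_mem g ⟨0, 0, n, by simp [expZ]⟩

/-- The projection `toTorus`, with values in the pi-type model of the torus on which Mathlib
develops Fourier series. -/
noncomputable def base (p : HeisNil) : UnitAddTorus (Fin 2) := ![(toTorus p).1, (toTorus p).2]

theorem base_mk (g : Heis) : base (QuotientGroup.mk g) = toTorus₂ g.x g.y := rfl

theorem base_smul (g : Heis) (p : HeisNil) : base (g • p) = base p + toTorus₂ g.x g.y := by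
  obtain ⟨g', rfl⟩ := QuotientGroup.mk_surjective p
  rw [← mk_mul, base_mk, base_mk, ← toTorus₂_add, Heis.mul_def, add_comm g.x, add_comm g.y]

theorem base_expZ_smul (s : ℝ) (p : HeisNil) : base (expZ s • p) = base p := by
  rw [base_smul]
  exact (congrArg _ toTorus₂_zero).trans (add_zero _)

theorem continuous_base : Continuous base :=
  (QuotientGroup.isQuotientMap_mk _).continuous_iff.2 <|
    continuous_toTorus₂.comp (Heis.continuous_x.prodMk Heis.continuous_y)

theorem isQuotientMap_base : IsQuotientMap base := by
  refine continuous_base.isClosedMap.isQuotientMap continuous_base fun w => ?_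
  obtain ⟨x, y, rfl⟩ := toTorus₂_surjective w
  exact ⟨QuotientGroup.mk ⟨x, y, 0⟩, rfl⟩

theorem exists_expZ_smul_eq {p p' : HeisNil} (h : base p = base p') : ∃ s, p' = expZ s • p := by
  obtain ⟨⟨x, y, z⟩, rfl⟩ := QuotientGroup.mk_surjective p
  obtain ⟨⟨x', y', z'⟩, rfl⟩ := QuotientGroup.mk_surjective p'
  obtain ⟨a, rfl⟩ := exists_int_add_of_coe_eq (congrFun h 0 : (x : UnitAddCircle) = x')
  obtain ⟨b, rfl⟩ := exists_int_add_of_coe_eq (congrFun h 1 : (y : UnitAddCircle) = y')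
  refine ⟨z' - (z + (x * b - a * y)), ?_⟩
  rw [← mk_mul]
  refine (QuotientGroup.eq.2 (show _ ∈ Heis.lattice from ⟨a, b, 0, ?_⟩)).symm
  ext <;> simp only [expZ, Heis.mul_def, Heis.inv_def, Int.cast_zero] <;> ring

theorem exists_torus_factor {E : Type*} [TopologicalSpace E] {f : HeisNil → E}
    (hf : Continuous f) (hf_inv : ∀ s p, f (expZ s • p) = f p) :
    ∃ φ : C(UnitAddTorus (Fin 2), E), ∀ p, φ (base p) = f p := by
  let b : C(HeisNil, UnitAddTorus (Fin 2)) := ⟨base, continuous_base⟩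
  have hb : IsQuotientMap b := isQuotientMap_base
  have hfac : Function.FactorsThrough (⟨f, hf⟩ : C(HeisNil, E)) b := fun p p' h => by
    obtain ⟨s, rfl⟩ := exists_expZ_smul_eq h
    exact (hf_inv s p).symm
  exact ⟨hb.lift _ hfac, DFunLike.congr_fun (hb.lift_comp _ hfac)⟩

section Skew

variable {α β : ℝ} {h : UnitAddCircle × UnitAddCircle → UnitAddCircle}

theorem skew_expZ_smul (s : ℝ) (p : HeisNil) :
    skew α β h (expZ s • p) = expZ s • skew α β h p := by
  have htorus : toTorus (expZ s • p) = toTorus p :=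
    Prod.ext (congrFun (base_expZ_smul s p) 0) (congrFun (base_expZ_smul s p) 1)
  rw [skew, skew, htorus, smul_smul, smul_smul, Heis.expZ_mul_comm]

theorem iterate_skew_expZ_smul (s : ℝ) (n : ℕ) (p : HeisNil) :
    (skew α β h)^[n] (expZ s • p) = expZ s • (skew α β h)^[n] p :=
  (show Function.Commute (skew α β h) (expZ s • ·) from skew_expZ_smul s).iterate_left n p

theorem base_iterate_skew (n : ℕ) (p : HeisNil) :
    base ((skew α β h)^[n] p) = base p + n • toTorus₂ α β := by
  induction n with
  | zero => simp
  | succ n ih => rw [Function.iterate_succ_apply', skew, base_smul, ih, succ_nsmul, add_assoc]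

variable {A B : ℤ} {h₀ : C(UnitAddTorus (Fin 2), ℝ)}

theorem skew_mk_of_isTorusLift (hh₀ : IsTorusLift h A B h₀) (g : Heis) :
    skew α β h (QuotientGroup.mk g) = QuotientGroup.mk
      ((⟨α, β, h₀ (toTorus₂ g.x g.y) + A * g.x + B * g.y⟩ : Heis) * g) :=
  skew_mk α β h g _ (hh₀ g.x g.y)

theorem continuous_skew (hh : Continuous h) : Continuous (skew α β h) := by
  obtain ⟨A, B, h₀, hh₀⟩ := exists_isTorusLift hh
  refine (QuotientGroup.isQuotientMap_mk _).continuous_iff.2 ?_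
  refine Continuous.congr ?_ fun g => (skew_mk_of_isTorusLift hh₀ g).symm
  have htorus : Continuous fun g : Heis => toTorus₂ g.x g.y :=
    continuous_toTorus₂.comp (Heis.continuous_x.prodMk Heis.continuous_y)
  exact QuotientGroup.continuous_mk.comp ((Heis.continuous_mk continuous_const continuous_const
    (by fun_prop)).mul continuous_id)

theorem skew_expY_smul (hh₀ : IsTorusLift h A B h₀) (r : ℝ) (p : HeisNil) :
    skew α β h (expY r • p) =
      expZ ((B + 2 * α) * r + (h₀ (base p + toTorus₂ 0 r) - h₀ (base p))) •
        expY r • skew α β h p := by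
  obtain ⟨g, rfl⟩ := QuotientGroup.mk_surjective p
  rw [← mk_mul, skew_mk_of_isTorusLift hh₀, skew_mk_of_isTorusLift hh₀, base_mk, ← toTorus₂_add,
    ← mk_mul, ← mk_mul]
  congr 1
  ext
  · simp [expY, expZ, Heis.mul_def]
  · simp only [expY, expZ, Heis.mul_def]
    ring
  · simp only [expY, expZ, Heis.mul_def, zero_add, add_zero, add_comm r]
    ring

/-- In the linear term, `B` is a degree of `h` and `2 * α` comes from commutators. -/
theorem iterate_skew_expY_smul (hh₀ : IsTorusLift h A B h₀) (r : ℝ) (j : ℕ) (p : HeisNil) :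
    (skew α β h)^[j] (expY r • p) =
      expZ (j * (B + 2 * α) * r + birkhoffIncrement h₀ (toTorus₂ α β) j r (base p)) •
        expY r • (skew α β h)^[j] p := by
  induction j with
  | zero => simp [birkhoffIncrement, Heis.expZ_zero]
  | succ j ih =>
    rw [Function.iterate_succ_apply', ih, skew_expZ_smul, skew_expY_smul hh₀, base_iterate_skew,
      ← Function.iterate_succ_apply' (skew α β h), smul_smul, ← Heis.expZ_add,
      birkhoffIncrement_succ, add_assoc (base p)]
    congr 2
    push_cast
    ring

end Skew

end HeisNil

theorem norm_mul_conj_sub_le {a b c d : ℂ} (ha : ‖a‖ ≤ 1) (hd : ‖d‖ ≤ 1) :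
    ‖a * conj b - c * conj d‖ ≤ ‖a - c‖ + ‖b - d‖ := by
  have hsplit : a * conj b - c * conj d = a * conj (b - d) + (a - c) * conj d := by
    rw [map_sub]
    ring
  rw [hsplit]
  refine (norm_add_le _ _).trans ?_
  rw [norm_mul, norm_mul, RCLike.norm_conj, RCLike.norm_conj, add_comm]
  exact add_le_add (mul_le_of_le_one_right (norm_nonneg _) hd)
    (mul_le_of_le_one_left (norm_nonneg _) ha)

theorem norm_fourierChar_add_mul_sub_le {z : ℂ} (hz : ‖z‖ ≤ 1) (a b : ℝ) :
    ‖𝐞 (a + b) * z - 𝐞 a * z‖ ≤ 2 * Real.pi * |b| := by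
  rw [coe_fourierChar_add, ← sub_mul, ← mul_sub_one, norm_mul, norm_mul, Circle.norm_coe, one_mul]
  exact (mul_le_of_le_one_right (norm_nonneg _) hz).trans (norm_fourierChar_sub_one_le b)

theorem le_add_sq_div (t : ℝ) {ε : ℝ} (hε : 0 < ε) : t ≤ ε + t ^ 2 / ε := by
  rw [← sub_le_iff_le_add', le_div_iff₀ hε]
  nlinarith [sq_nonneg (t - ε), sq_nonneg t]

theorem tendsto_integral_zero_of_eventually_le {X : Type*} [MeasurableSpace X] {P : Measure X}
    [IsProbabilityMeasure P] {Φ Q : ℕ → X → ℝ} (hΦ : ∀ k x, 0 ≤ Φ k x)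
    (hQ : ∀ k, Integrable (Q k) P) (hQ0 : Tendsto (fun k => ∫ x, Q k x ∂P) atTop (𝓝 0))
    (hle : ∀ ε : ℝ, 0 < ε → ∃ D : ℝ, ∀ᶠ k in atTop, ∀ x, Φ k x ≤ ε + D * Q k x) :
    Tendsto (fun k => ∫ x, Φ k x ∂P) atTop (𝓝 0) := by
  refine tendsto_order.2 ⟨fun a ha => Eventually.of_forall fun k =>
    ha.trans_le (integral_nonneg (hΦ k)), fun ε hε => ?_⟩
  obtain ⟨D, hD⟩ := hle (ε / 2) (half_pos hε)
  have hDQ : Tendsto (fun k => D * ∫ x, Q k x ∂P) atTop (𝓝 0) := by simpa using hQ0.const_mul D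
  filter_upwards [hD, hDQ.eventually_lt_const (half_pos hε)] with k hk hQk
  have hint := (hQ k).const_mul D
  calc ∫ x, Φ k x ∂P ≤ ∫ x, (ε / 2 + D * Q k x) ∂P :=
        integral_mono_of_nonneg (Eventually.of_forall (hΦ k)) ((integrable_const _).add hint)
          (Eventually.of_forall hk)
    _ = ε / 2 + D * ∫ x, Q k x ∂P := by
        rw [integral_add (integrable_const _) hint, integral_const_mul, integral_const,
          probReal_univ, one_smul]
    _ < ε := by linarith

section TorusCorrelations

variable {d : Type*} [Fintype d]

theorem integral_comp_add_nsmul {E : Type*} [NormedAddCommGroup E] [NormedSpace ℝ E]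
    {g : UnitAddTorus d → E} (hg : Continuous g) {n : ℕ} (hn : n ≠ 0) (w₀ : UnitAddTorus d) :
    ∫ w, g (w₀ + n • w) ∂(torusHaar d) = ∫ w, g w ∂(torusHaar d) := by
  have hpres : MeasurePreserving (fun w : UnitAddTorus d => n • w) (torusHaar d) (torusHaar d) := by
    simpa only [natCast_zsmul] using
      Measure.measurePreserving_zsmul (torusHaar d) (Int.natCast_ne_zero.2 hn)
  have hshift := integral_add_left_eq_self (μ := torusHaar d) g w₀
  rw [← hshift]
  conv_rhs => rw [← hpres.map_eq]
  rw [integral_map hpres.aemeasurable]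
  exact Continuous.aestronglyMeasurable (by fun_prop)

/-- Translation by `a` approximately changes the sign of `U * conj V`, but not its integral. -/
theorem two_mul_norm_integral_mul_conj_le {U V : UnitAddTorus d → ℂ} (hU : Continuous U)
    (hV : Continuous V) (hU1 : ∀ w, ‖U w‖ ≤ 1) (hV1 : ∀ w, ‖V w‖ ≤ 1) {b c : ℂ} (hc : ‖c‖ = 1)
    (hbc : b * conj c = -1) (a : UnitAddTorus d) :
    2 * ‖∫ w, U w * conj (V w) ∂(torusHaar d)‖ ≤
      ∫ w, ‖U (w + a) - b * U w‖ ∂(torusHaar d) + ∫ w, ‖V (w + a) - c * V w‖ ∂(torusHaar d) := by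
  have hdouble : 2 * ∫ w, U w * conj (V w) ∂(torusHaar d) =
      ∫ w, (U (w + a) * conj (V (w + a)) - b * U w * conj (c * V w)) ∂(torusHaar d) := by
    have hflip : ∀ w, b * U w * conj (c * V w) = -(U w * conj (V w)) := fun w => by
      rw [map_mul]
      linear_combination U w * conj (V w) * hbc
    simp_rw [hflip, sub_neg_eq_add]
    rw [integral_add (integrable_torusHaar (by fun_prop)) (integrable_torusHaar (by fun_prop)),
      integral_add_right_eq_self (μ := torusHaar d) (fun w => U w * conj (V w)) a, two_mul]
  rw [← integral_add (integrable_torusHaar (by fun_prop)) (integrable_torusHaar (by fun_prop)),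
    ← Complex.norm_two, ← norm_mul, hdouble]
  refine norm_integral_le_of_norm_le (integrable_torusHaar (by fun_prop))
    (Eventually.of_forall fun w => norm_mul_conj_sub_le (hU1 _) ?_)
  rw [norm_mul, hc, one_mul]
  exact hV1 w

end TorusCorrelations

namespace HeisNil

open Heis (expZ expY)

/-- The functions on which the centre acts through its character of frequency `m`. -/
def HasCentralFrequency (m : ℤ) (f : HeisNil → ℂ) : Prop :=
  ∀ s p, f (expZ s • p) = 𝐞 (m * s) * f p

/-- `G j` is the correlation `f ∘ T^[j] * conj f`, seen as a function on the torus. -/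
def IsOrbitCorrelation (T : HeisNil → HeisNil) (f : HeisNil → ℂ)
    (G : ℕ → C(UnitAddTorus (Fin 2), ℂ)) : Prop :=
  ∀ j p, G j (base p) = f (T^[j] p) * conj (f p)

section Correlations

variable {α β : ℝ} {h : UnitAddCircle × UnitAddCircle → UnitAddCircle} {A B : ℤ}
  {h₀ : C(UnitAddTorus (Fin 2), ℝ)} {f : HeisNil → ℂ} {m : ℤ}
  {G : ℕ → C(UnitAddTorus (Fin 2), ℂ)} {K : ℝ}

theorem exists_isOrbitCorrelation (hh : Continuous h) (hf : Continuous f)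
    (hfm : HasCentralFrequency m f) : ∃ G, IsOrbitCorrelation (skew α β h) f G := by
  have hcont : ∀ j, Continuous fun p => f ((skew α β h)^[j] p) * conj (f p) := fun j =>
    (hf.comp ((continuous_skew hh).iterate j)).mul (Complex.continuous_conj.comp hf)
  refine Classical.skolem.1 fun j => exists_torus_factor (hcont j) fun s p => ?_
  have hphase : (𝐞 (m * s) : ℂ) * conj (𝐞 (m * s) : ℂ) = 1 := by
    rw [Complex.mul_conj', Circle.norm_coe, Complex.ofReal_one, one_pow]
  rw [iterate_skew_expZ_smul, hfm, hfm, map_mul (starRingEnd ℂ), mul_mul_mul_comm, hphase, one_mul]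

theorem IsOrbitCorrelation.norm_le_one {T : HeisNil → HeisNil} (hG : IsOrbitCorrelation T f G)
    (hf1 : ∀ p, ‖f p‖ ≤ 1) (j : ℕ) (w : UnitAddTorus (Fin 2)) : ‖G j w‖ ≤ 1 := by
  obtain ⟨p, rfl⟩ := isQuotientMap_base.surjective w
  rw [hG]
  exact norm_mul_conj_le_one (hf1 _) (hf1 _)

theorem IsOrbitCorrelation.norm_translate_sub_le (hG : IsOrbitCorrelation (skew α β h) f G)
    (hh₀ : IsTorusLift h A B h₀) (hfm : HasCentralFrequency m f) (hf1 : ∀ p, ‖f p‖ ≤ 1) {ε r : ℝ}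
    (hr : ∀ p, ‖f (expY r • p) - f p‖ ≤ ε) (j : ℕ) (w : UnitAddTorus (Fin 2)) :
    ‖G j (w + toTorus₂ 0 r) - 𝐞 (m * (j * (B + 2 * α) * r) +
      m * birkhoffIncrement h₀ (toTorus₂ α β) j r w) * G j w‖ ≤ 2 * ε := by
  obtain ⟨p, rfl⟩ := isQuotientMap_base.surjective w
  have hbase : base p + toTorus₂ 0 r = base (expY r • p) := (base_smul (expY r) p).symm
  rw [hbase, hG, hG, iterate_skew_expY_smul hh₀, hfm, mul_assoc, mul_add, ← mul_sub, norm_mul,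
    Circle.norm_coe, one_mul, two_mul]
  exact (norm_mul_conj_sub_le (hf1 _) (hf1 _)).trans (add_le_add (hr _) (hr _))

theorem IsOrbitCorrelation.tendsto_integral_norm_translate_sub
    (hG : IsOrbitCorrelation (skew α β h) f G) (hf : Continuous f) (hfm : HasCentralFrequency m f)
    (hf1 : ∀ p, ‖f p‖ ≤ 1) (hαβ : LinearIndependent ℚ ![α, β, 1]) (hh₀ : IsTorusLift h A B h₀)
    (hK : ∀ᶠ r in 𝓝[>] 0, ∀ w, |h₀ (w + toTorus₂ 0 r) - h₀ w| ≤ K * r) (p : ℕ) (s : ℝ) :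
    Tendsto (fun k : ℕ => ∫ w, ‖G (p * k) (w + toTorus₂ 0 (s / k)) -
      𝐞 (m * (p * (B + 2 * α) * s)) * G (p * k) w‖ ∂(torusHaar (Fin 2))) atTop (𝓝 0) := by
  let b : ℕ → UnitAddTorus (Fin 2) → ℝ := fun k =>
    birkhoffIncrement h₀ (toTorus₂ α β) (p * k) (s / k)
  have hb : ∀ k, Continuous (b k) := fun k => continuous_birkhoffIncrement _ _ _ _
  refine tendsto_integral_zero_of_eventually_le (Q := fun k w => b k w ^ 2)
    (fun k w => norm_nonneg _) (fun k => integrable_torusHaar (by fun_prop))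
    (tendsto_integral_sq_birkhoffIncrement (fun _ => mFourier_toTorus₂_ne_one hαβ) hK p s)
    fun ε hε => ⟨(2 * Real.pi * m) ^ 2 / (ε / 2), ?_⟩
  have hsmall := eventually_forall_norm_sub_lt (Ψ := fun r q => f (expY r • q))
    (hf.comp ((Heis.continuous_expY.comp continuous_fst).smul continuous_snd)) 0
    (show 0 < ε / 4 by positivity)
  filter_upwards [(tendsto_const_div_atTop_nhds_zero_nat s).eventually hsmall,
    eventually_ne_atTop 0] with k hk hk0 w
  simp only [Heis.expY_zero, one_smul] at hk
  have hstep := hG.norm_translate_sub_le hh₀ hfm hf1 (fun q => (hk q).le) (p * k) w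
  have hrescale : ((p * k : ℕ) : ℝ) * (B + 2 * α) * (s / k) = p * (B + 2 * α) * s := by
    push_cast
    field_simp
  rw [hrescale] at hstep
  have hphase := norm_fourierChar_add_mul_sub_le (hG.norm_le_one hf1 (p * k) w)
    (m * (p * (B + 2 * α) * s)) (m * b k w)
  have hamgm := le_add_sq_div (2 * Real.pi * |m * b k w|) (half_pos hε)
  have hsq : (2 * Real.pi * |m * b k w|) ^ 2 / (ε / 2) =
      (2 * Real.pi * m) ^ 2 / (ε / 2) * b k w ^ 2 := by
    rw [mul_pow, sq_abs]
    ring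
  have htri := norm_sub_le_norm_sub_add_norm_sub (G (p * k) (w + toTorus₂ 0 (s / k)))
    (𝐞 (m * (p * (B + 2 * α) * s) + m * b k w) * G (p * k) w)
    (𝐞 (m * (p * (B + 2 * α) * s)) * G (p * k) w)
  linarith

theorem intCast_add_two_mul_ne_zero (hαβ : LinearIndependent ℚ ![α, β, 1]) (B : ℤ) :
    (B + 2 * α : ℝ) ≠ 0 := by
  intro h0
  have hcoord := Fintype.linearIndependent_iff.1 hαβ ![2, 0, (B : ℚ)] (by
    simp only [Fin.sum_univ_three, Matrix.cons_val, Rat.smul_def]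
    push_cast
    linarith) 0
  norm_num at hcoord

theorem exists_fourierChar_mul_conj_eq_neg_one {κ : ℝ} (hκ : κ ≠ 0) {p q : ℕ} (hpq : p ≠ q) :
    ∃ s : ℝ, (𝐞 (κ * (p * (p * s))) : ℂ) * conj (𝐞 (κ * (q * (q * s))) : ℂ) = -1 := by
  have hsq : ((p : ℝ) ^ 2 - q ^ 2) ≠ 0 := by
    rw [sub_ne_zero]
    exact_mod_cast fun h => hpq (Nat.pow_left_injective two_ne_zero h)
  refine ⟨1 / 2 / (κ * (p ^ 2 - q ^ 2)), ?_⟩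
  rw [conj_fourierChar, ← coe_fourierChar_add, ← coe_fourierChar_half]
  congr 2
  field_simp
  ring

/-- The translation by `s / k` multiplies `G (p * k) (w₀ + p • w)` by a phase quadratic in `p`,
so `s` can be chosen to make the phases for `p` and `q` opposite. -/
theorem IsOrbitCorrelation.tendsto_integral_mul_conj (hG : IsOrbitCorrelation (skew α β h) f G)
    (hf : Continuous f) (hfm : HasCentralFrequency m f) (hm : m ≠ 0) (hf1 : ∀ p, ‖f p‖ ≤ 1)
    (hαβ : LinearIndependent ℚ ![α, β, 1]) (hh₀ : IsTorusLift h A B h₀)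
    (hK : ∀ᶠ r in 𝓝[>] 0, ∀ w, |h₀ (w + toTorus₂ 0 r) - h₀ w| ≤ K * r) {p q : ℕ} (hp : p ≠ 0)
    (hq : q ≠ 0) (hpq : p ≠ q) (w₀ : UnitAddTorus (Fin 2)) :
    Tendsto (fun k : ℕ => ∫ w, G (p * k) (w₀ + p • w) * conj (G (q * k) (w₀ + q • w))
      ∂(torusHaar (Fin 2))) atTop (𝓝 0) := by
  obtain ⟨s, hs⟩ := exists_fourierChar_mul_conj_eq_neg_one
    (mul_ne_zero (Int.cast_ne_zero.2 hm) (intCast_add_two_mul_ne_zero hαβ B)) hpq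
  let c : ℕ → ℂ := fun p => 𝐞 (m * (B + 2 * α) * (p * (p * s)))
  let I : ℕ → ℕ → ℝ := fun p k => ∫ w, ‖G (p * k) (w₀ + p • (w + toTorus₂ 0 (s / k))) -
    c p * G (p * k) (w₀ + p • w)‖ ∂(torusHaar (Fin 2))
  have hI : ∀ {p}, p ≠ 0 → Tendsto (I p) atTop (𝓝 0) := fun {p} hp => by
    refine (hG.tendsto_integral_norm_translate_sub hf hfm hf1 hαβ hh₀ hK p (p * s)).congr
      fun k => ?_
    rw [← integral_comp_add_nsmul (by fun_prop) hp w₀]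
    have hnsmul : toTorus₂ 0 (p * s / k) = p • toTorus₂ 0 (s / k) := by
      rw [← toTorus₂_nsmul, mul_zero, mul_div_assoc]
    have hphase : m * (p * (B + 2 * α) * (p * s)) = m * (B + 2 * α) * (p * (p * s)) := by ring
    simp only [hnsmul, hphase, add_assoc, I, c, smul_add]
  refine squeeze_zero_norm (fun k => ?_) (by simpa using (hI hp).add (hI hq))
  have hbound := two_mul_norm_integral_mul_conj_le (U := fun w => G (p * k) (w₀ + p • w))
    (V := fun w => G (q * k) (w₀ + q • w)) (by fun_prop) (by fun_prop)
    (fun w => hG.norm_le_one hf1 _ _) (fun w => hG.norm_le_one hf1 _ _)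
    (Circle.norm_coe _) hs (toTorus₂ 0 (s / k))
  refine le_trans ?_ hbound
  linarith [norm_nonneg
    (∫ w, G (p * k) (w₀ + p • w) * conj (G (q * k) (w₀ + q • w)) ∂(torusHaar (Fin 2)))]

theorem HasCentralFrequency.hasMean_orbit_mul_conj (hfm : HasCentralFrequency m f) (hm : m ≠ 0)
    (hf : Continuous f) (hf1 : ∀ p, ‖f p‖ ≤ 1) (hαβ : LinearIndependent ℚ ![α, β, 1])
    (hh : Continuous h) {L : NNReal} (hLip : ∀ s, LipschitzWith L fun t => h (s, t)) {p q : ℕ}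
    (hp : p ≠ 0) (hq : q ≠ 0) (hpq : p ≠ q) (x : HeisNil) :
    HasMean (fun n => f ((skew α β h)^[p * n] x) * conj (f ((skew α β h)^[q * n] x))) 0 := by
  obtain ⟨A, B, h₀, hh₀⟩ := exists_isTorusLift hh
  obtain ⟨G, hG⟩ := exists_isOrbitCorrelation (α := α) (β := β) hh hf hfm
  refine hasMean_zero_of_correlations (fun n => norm_mul_conj_le_one (hf1 _) (hf1 _))
    (fun k => ?_) (hG.tendsto_integral_mul_conj hf hfm hm hf1 hαβ hh₀
      (hh₀.eventually_abs_sub_le hLip) hp hq hpq (base x))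
  let Φ : C(UnitAddTorus (Fin 2), ℂ) :=
    ⟨fun w => G (p * k) (base x + p • w) * conj (G (q * k) (base x + q • w)), by fun_prop⟩
  have horbit := hasMean_torus_orbit (fun _ => mFourier_toTorus₂_ne_one hαβ) Φ 0
  refine (congrArg (HasMean · (∫ w, Φ w ∂(torusHaar (Fin 2)))) (funext fun n => ?_)).mp horbit
  have hcorr : ∀ p : ℕ, G (p * k) (base x + p • (0 + n • toTorus₂ α β)) =
      f ((skew α β h)^[p * (n + k)] x) * conj (f ((skew α β h)^[p * n] x)) := fun p => by
    rw [zero_add, smul_smul, ← base_iterate_skew (h := h), hG, ← Function.iterate_add_apply,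
      ← mul_add, add_comm k]
  simp only [Φ, ContinuousMap.coe_mk, hcorr, map_mul, Complex.conj_conj]
  ring

end Correlations

end HeisNil

section VectorFourier

variable {T : ℝ} [Fact (0 < T)] {E F : Type*} [NormedAddCommGroup E] [NormedSpace ℂ E]
  [NormedAddCommGroup F] [NormedSpace ℂ F]

theorem fourierCoeff_translate (g : AddCircle T → E) (a : AddCircle T) (n : ℤ) :
    fourierCoeff (fun t => g (t + a)) n = fourier n a • fourierCoeff g n := by
  rw [fourierCoeff, fourierCoeff, ← integral_smul,
    ← integral_add_right_eq_self (fun t => fourier n a • fourier (-n) t • g t) a]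
  refine integral_congr_ae (Eventually.of_forall fun t => ?_)
  have hphase : fourier n a * fourier (-n) (t + a) = fourier (-n) t := by
    rw [fourier_apply, fourier_apply, fourier_apply, ← Circle.coe_mul, ← AddCircle.toCircle_add]
    congr 2
    simp
  simp only [smul_smul, hphase]

theorem fourierCoeff_continuousLinearMap_comp [CompleteSpace E] [CompleteSpace F]
    (L : E →L[ℂ] F) (g : C(AddCircle T, E)) (n : ℤ) :
    fourierCoeff (fun t => L (g t)) n = L (fourierCoeff g n) := by
  have hint : Integrable (fun t => fourier (-n) t • g t) (AddCircle.haarAddCircle (T := T)) :=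
    Continuous.integrable_of_hasCompactSupport (by fun_prop) (HasCompactSupport.of_compactSpace _)
  rw [fourierCoeff, fourierCoeff, ← L.integral_comp_comm hint]
  simp only [map_smul]

theorem eq_zero_of_fourierCoeff_eq_zero {g : C(AddCircle T, ℂ)} (hg : ∀ n, fourierCoeff g n = 0)
    (t : AddCircle T) : g t = 0 := by
  have hsummable : Summable (fourierCoeff g) := by
    rw [show fourierCoeff g = 0 from funext hg]
    exact summable_zero
  have hsum := has_pointwise_sum_fourier_series_of_summable hsummable t
  simp only [hg, zero_smul] at hsum
  exact hsum.unique hasSum_zero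

theorem mem_topologicalClosure_span_fourierCoeff [CompleteSpace E] (g : C(AddCircle T, E))
    (t : AddCircle T) :
    g t ∈ (Submodule.span ℂ (Set.range (fourierCoeff g))).topologicalClosure := by
  set S := (Submodule.span ℂ (Set.range (fourierCoeff g))).topologicalClosure
  have : IsClosed (S : Set E) := Submodule.isClosed_topologicalClosure _
  rw [← Submodule.Quotient.mk_eq_zero]
  by_contra hne
  obtain ⟨L, hL⟩ := SeparatingDual.exists_ne_zero (R := ℂ) hne
  let L' : E →L[ℂ] ℂ := L.comp S.mkQL
  refine hL (eq_zero_of_fourierCoeff_eq_zero (g := ⟨fun t => L' (g t), by fun_prop⟩)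
    (fun n => ?_) t)
  have hmem : fourierCoeff g n ∈ S :=
    Submodule.le_topologicalClosure _ (Submodule.subset_span ⟨n, rfl⟩)
  refine (fourierCoeff_continuousLinearMap_comp L' g n).trans ?_
  exact (congrArg L ((Submodule.Quotient.mk_eq_zero S).2 hmem)).trans (map_zero L)

end VectorFourier

theorem hasMean_mul_of_mem_closure_span {X : Type*} [TopologicalSpace X] [CompactSpace X]
    {x : ℕ → X} {ν : ℕ → ℂ} (hν : ∀ n, ‖ν n‖ ≤ 1) {S : Set C(X, ℂ)}
    (hS : ∀ g ∈ S, HasMean (fun n => g (x n) * ν n) 0) {g : C(X, ℂ)}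
    (hg : g ∈ (Submodule.span ℂ S).topologicalClosure) : HasMean (fun n => g (x n) * ν n) 0 := by
  have hspan : ∀ g ∈ Submodule.span ℂ S, HasMean (fun n => g (x n) * ν n) 0 := fun g hg => by
    induction hg using Submodule.span_induction with
    | mem g hg => exact hS g hg
    | zero => simpa using HasMean.const 0
    | add f g _ _ hf hg => simpa [add_mul] using hf.add hg
    | smul c f _ hf => simpa [mul_assoc] using hf.const_mul c
  refine HasMean.of_uniform_approx fun ε hε => ?_
  obtain ⟨f, hf, hgf⟩ := Metric.mem_closure_iff.1 hg ε hε
  refine ⟨_, hspan f hf, fun n => ?_⟩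
  rw [← sub_mul, norm_mul]
  refine (mul_le_of_le_one_right (norm_nonneg _) (hν n)).trans ?_
  exact ((g - f).norm_coe_le_norm _).trans (dist_eq_norm g f ▸ hgf.le)

section TorusOrbits

variable {d : Type*} [Fintype d] {θ : UnitAddTorus d} {ν : ArithmeticFunction ℂ}

theorem mFourier_nsmul_apply (n : ℕ) (ξ : d → ℤ) (w : UnitAddTorus d) :
    mFourier (n • ξ) w = mFourier ξ w ^ n := by
  induction n with
  | zero => rw [zero_smul, UnitAddTorus.mFourier_zero, pow_zero, ContinuousMap.one_apply]
  | succ n ih => rw [succ_nsmul, UnitAddTorus.mFourier_add, ih, pow_succ]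

theorem hasMean_mFourier_mul_conj (hθ : ∀ ξ : d → ℤ, ξ ≠ 0 → mFourier ξ θ ≠ 1) {ξ : d → ℤ}
    (hξ : ξ ≠ 0) {p q : ℕ} (hpq : p ≠ q) (w : UnitAddTorus d) :
    HasMean (fun n => mFourier ξ (w + (p * n) • θ) * conj (mFourier ξ (w + (q * n) • θ))) 0 := by
  have hz : mFourier (p • ξ + -(q • ξ)) θ ≠ 1 := hθ _ <| by
    rw [← sub_eq_add_neg, sub_ne_zero]
    exact fun h => hpq (Nat.cast_injective (smul_left_injective ℤ hξ
      (by simpa only [natCast_zsmul] using h)))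
  convert hasMean_pow (norm_mFourier_apply _ _) hz using 2 with n
  have hunit : mFourier ξ w * conj (mFourier ξ w) = 1 := by
    rw [Complex.mul_conj', norm_mFourier_apply, Complex.ofReal_one, one_pow]
  simp only [UnitAddTorus.mFourier_add, UnitAddTorus.mFourier_neg, mFourier_nsmul_apply,
    mFourier_apply_add, mFourier_apply_nsmul, map_mul, map_pow, mul_pow, pow_mul]
  linear_combination ((mFourier ξ θ ^ p) ^ n * (conj (mFourier ξ θ) ^ q) ^ n) * hunit

theorem hasMean_torus_orbit_mul (hθ : ∀ ξ : d → ℤ, ξ ≠ 0 → mFourier ξ θ ≠ 1)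
    (hν : ν.IsMultiplicative) (hν1 : ∀ n, ‖ν n‖ ≤ 1) (hν0 : HasMean ν 0)
    (g : C(UnitAddTorus d, ℂ)) (w : UnitAddTorus d) :
    HasMean (fun n => g (w + n • θ) * ν n) 0 := by
  refine hasMean_mul_of_mem_closure_span (x := fun n => w + n • θ) hν1
    (S := Set.range (mFourier (d := d))) ?_
    (UnitAddTorus.span_mFourier_closure_eq_top (d := d) ▸ Submodule.mem_top)
  rintro _ ⟨ξ, rfl⟩
  by_cases hξ : ξ = 0
  · simpa [hξ, UnitAddTorus.mFourier_zero] using hν0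
  · exact hasMean_mul_of_prime_correlations (fun n => (norm_mFourier_apply _ _).le) hν hν1
      fun p q _ _ hpq => hasMean_mFourier_mul_conj hθ hξ hpq w

end TorusOrbits

namespace HeisNil

open Heis (expZ)

/-- The action of the centre on a function, as a map from the real line. -/
noncomputable def centralTranslate (f : C(HeisNil, ℂ)) : C(ℝ, C(HeisNil, ℂ)) :=
  ContinuousMap.curry ⟨fun q => f (expZ q.1 • q.2),
    f.continuous.comp ((Heis.continuous_expZ.comp continuous_fst).smul continuous_snd)⟩

theorem centralTranslate_periodic (f : C(HeisNil, ℂ)) :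
    Function.Periodic (centralTranslate f) 1 := fun t => by
  ext p
  have h1 := expZ_intCast_smul 1 p
  rw [Int.cast_one] at h1
  exact congrArg f (by rw [Heis.expZ_add, mul_smul, h1])

/-- The orbit of a function under the centre, as a map from the circle: its Fourier coefficients
are the components of the function for the action of the centre. -/
noncomputable def centralOrbit (f : C(HeisNil, ℂ)) : C(UnitAddCircle, C(HeisNil, ℂ)) :=
  ⟨(centralTranslate_periodic f).lift,
    (QuotientAddGroup.isQuotientMap_mk _).continuous_iff.2 (centralTranslate f).continuous⟩

theorem centralOrbit_coe_apply (f : C(HeisNil, ℂ)) (t : ℝ) (p : HeisNil) :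
    centralOrbit f t p = f (expZ t • p) := rfl

theorem centralOrbit_apply_expZ_smul (f : C(HeisNil, ℂ)) (t : UnitAddCircle) (s : ℝ)
    (p : HeisNil) : centralOrbit f t (expZ s • p) = centralOrbit f (t + s) p := by
  obtain ⟨t, rfl⟩ := QuotientAddGroup.mk_surjective t
  refine Eq.trans ?_ (centralOrbit_coe_apply f (t + s) p).symm
  rw [Heis.expZ_add, mul_smul]
  rfl

theorem hasCentralFrequency_fourierCoeff (f : C(HeisNil, ℂ)) (m : ℤ) :
    HasCentralFrequency m (fourierCoeff (centralOrbit f) m : C(HeisNil, ℂ)) := fun s p => by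
  have heval : ∀ q, fourierCoeff (centralOrbit f) m q =
      fourierCoeff (fun t => centralOrbit f t q) m := fun q =>
    (fourierCoeff_continuousLinearMap_comp (ContinuousMap.evalCLM ℂ q) (centralOrbit f) m).symm
  have hchar : fourier m (s : UnitAddCircle) = 𝐞 (m * s) := by
    rw [fourier_coe_apply, Real.fourierChar_apply]
    push_cast
    ring_nf
  simp only [heval, centralOrbit_apply_expZ_smul]
  rw [fourierCoeff_translate (fun t => centralOrbit f t p), hchar, smul_eq_mul]

theorem mem_topologicalClosure_span_central_fourierCoeff (f : C(HeisNil, ℂ)) :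
    f ∈ (Submodule.span ℂ (Set.range (fourierCoeff (centralOrbit f)))).topologicalClosure := by
  convert mem_topologicalClosure_span_fourierCoeff (centralOrbit f) ((0 : ℝ) : UnitAddCircle)
    using 1
  ext p
  rw [centralOrbit_coe_apply, Heis.expZ_zero, one_smul]

section Orbits

variable {α β : ℝ} {h : UnitAddCircle × UnitAddCircle → UnitAddCircle} {f : C(HeisNil, ℂ)} {m : ℤ}
  {ν : ArithmeticFunction ℂ}

theorem HasCentralFrequency.hasMean_orbit_mul_of_eq_zero (hf : HasCentralFrequency 0 f)
    (hαβ : LinearIndependent ℚ ![α, β, 1]) (hν : ν.IsMultiplicative) (hν1 : ∀ n, ‖ν n‖ ≤ 1)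
    (hν0 : HasMean ν 0) (p : HeisNil) :
    HasMean (fun n => f ((skew α β h)^[n] p) * ν n) 0 := by
  obtain ⟨φ, hφ⟩ := exists_torus_factor f.continuous fun s p => by simpa using hf s p
  simpa only [← hφ, base_iterate_skew] using hasMean_torus_orbit_mul
    (fun _ => mFourier_toTorus₂_ne_one hαβ) hν hν1 hν0 φ (base p)

theorem HasCentralFrequency.const_mul {f : HeisNil → ℂ} (hf : HasCentralFrequency m f) (c : ℂ) :
    HasCentralFrequency m fun p => c * f p := fun s p => by
  simp only [hf s p, mul_left_comm]

theorem HasCentralFrequency.hasMean_orbit_mul_of_ne_zero (hfm : HasCentralFrequency m f)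
    (hm : m ≠ 0) (hαβ : LinearIndependent ℚ ![α, β, 1]) (hh : Continuous h) {K : NNReal}
    (hLip : ∀ s, LipschitzWith K fun t => h (s, t)) (hν : ν.IsMultiplicative)
    (hν1 : ∀ n, ‖ν n‖ ≤ 1) (p : HeisNil) :
    HasMean (fun n => f ((skew α β h)^[n] p) * ν n) 0 := by
  let C : ℝ := ‖f‖ + 1
  have hC : 0 < C := by positivity
  have hC0 : (C : ℂ) ≠ 0 := Complex.ofReal_ne_zero.2 hC.ne'
  have hf1 : ∀ p, ‖(C : ℂ)⁻¹ * f p‖ ≤ 1 := fun p => by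
    rw [norm_mul, norm_inv, Complex.norm_real, Real.norm_of_nonneg hC.le, inv_mul_le_iff₀ hC,
      mul_one]
    exact (f.norm_coe_le_norm p).trans (le_add_of_nonneg_right zero_le_one)
  have hnormalized := hasMean_mul_of_prime_correlations (F := fun n => (C : ℂ)⁻¹ * f _)
    (fun n => hf1 ((skew α β h)^[n] p)) hν hν1 fun p' q hp hq hpq =>
      (hfm.const_mul (C : ℂ)⁻¹).hasMean_orbit_mul_conj hm (by fun_prop) hf1 hαβ hh hLip
        hp.ne_zero hq.ne_zero hpq p
  simpa only [mul_assoc, mul_inv_cancel_left₀ hC0, mul_zero] using hnormalized.const_mul C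

end Orbits

end HeisNil

theorem theorem1p1_general {α β : ℝ} (hαβ : LinearIndependent ℚ ![α, β, 1])
    {h : UnitAddCircle × UnitAddCircle → UnitAddCircle} (hh : Continuous h) {K : NNReal}
    (hLip : ∀ s, LipschitzWith K fun t => h (s, t)) {ν : ArithmeticFunction ℂ}
    (hν : ν.IsMultiplicative) (hν1 : ∀ n, ‖ν n‖ ≤ 1) (hν0 : HasMean ν 0) (p : HeisNil)
    (f : C(HeisNil, ℂ)) : HasMean (fun n => f ((HeisNil.skew α β h)^[n] p) * ν n) 0 := by
  refine hasMean_mul_of_mem_closure_span (x := fun n => (HeisNil.skew α β h)^[n] p) hν1 ?_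
    (HeisNil.mem_topologicalClosure_span_central_fourierCoeff f)
  rintro _ ⟨m, rfl⟩
  have hfreq := HeisNil.hasCentralFrequency_fourierCoeff f m
  by_cases hm : m = 0
  · subst hm
    exact hfreq.hasMean_orbit_mul_of_eq_zero hαβ hν hν1 hν0 p
  · exact hfreq.hasMean_orbit_mul_of_ne_zero hm hαβ hh hLip hν hν1 p

theorem theorem1p1 (α β : ℝ) (hαβ : LinearIndependent ℚ ![α, β, 1])
    (h : UnitAddCircle × UnitAddCircle → UnitAddCircle) (hh : ∃ K : NNReal, LipschitzWith K h)
    (p : HeisNil) (f : C(HeisNil, ℂ)) :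
    Filter.Tendsto
      (fun N : ℕ => (1 / (N : ℂ)) * ∑ n ∈ Finset.Icc 1 N,
        f ((HeisNil.skew α β h)^[n] p) * (ArithmeticFunction.moebius n : ℂ))
      Filter.atTop (nhds 0) := by
  obtain ⟨K, hK⟩ := hh
  exact theorem1p1_general (ν := (ArithmeticFunction.moebius : ArithmeticFunction ℂ)) hαβ
    hK.continuous (fun s => hK.comp (LipschitzWith.prodMk_left s))
    ArithmeticFunction.isMultiplicative_moebius.intCast norm_moebius_le_one hasMean_moebius p f
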